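/- Let $m_1,m_2,n\in\mathbb N$, $m=m_1+m_2$, and consider the Dirac system on $[0,\infty)$ $$\frac{d}{dx}y(x,z)=\mathrm i\,(zj+jV(x))\,y(x,z),\qquad j=\begin{bmatrix}I_{m_1}&0\\0&-I_{m_2}\end{bmatrix},\quad V=\begin{bmatrix}0&v\\v^*&0\end{bmatrix},$$ with $m_1\times m_2$ potential $v$. Let $u(x,z)$ be its fundamental solution normalized by $u(0,z)=I_m$. For $x\ge 0$ and $z\in\mathbb C_+$ (the open upper half-plane) let $\mathcal N(x,z)$ be the set of values at $z$ (singularities being removed) of the matrix functions $$\begin{bmatrix}0&I_{m_2}\end{bmatrix}u(x,\cdot)^{-1}\mathcal P\Big(\begin{bmatrix}I_{m_1}&0\end{bmatrix}u(x,\cdot)^{-1}\mathcal P\Big)^{-1},$$ where $\mathcal P$ runs over the $m\times m_1$ matrix functions meromorphic in $\mathbb C_+$ such that $\mathcal P^*\mathcal P>0$ and $\mathcal P^*j\mathcal P\ge0$ in $\mathbb C_+$ outside a discrete set. For locally summable $v$, the Weyl function of the system is the $m_2\times m_1$ matrix function $\varphi$ on $\mathbb C_+$ determined by $\{\varphi(z)\}=\bigcap_{0\le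 x<\infty}\mathcal N(x,z)$. Let $\alpha,\Sigma_0\in\mathbb C^{n\times n}$, $\vartheta_1\in\mathbb C^{n\times m_1}$, $\vartheta_2\in\mathbb C^{n\times m_2}$ satisfy $$\Sigma_0>0,\qquad \alpha\Sigma_0-\Sigma_0\alpha^*=\mathrm i(\vartheta_1\vartheta_1^*-\vartheta_2\vartheta_2^*),$$ and let $v$ be the generalized pseudo-exponential potential generated by them, that is, for $x\ge0$, $$v(x)=-2\mathrm i\,\vartheta_1^*\mathrm e^{\mathrm ix\alpha^*}\Sigma(x)^{-1}\mathrm e^{\mathrm ix\alpha}\vartheta_2,\qquad \Sigma(x)=\Sigma_0+\int_0^x\Lambda(t)\Lambda(t)^*dt,\qquad \Lambda(x)=\begin{bmatrix}\mathrm e^{-\mathrm ix\alpha}\vartheta_1&\mathrm e^{\mathrm ix\alpha}\vartheta_2\end{bmatrix}.$$ Put $\theta=\alpha-\mathrm i\vartheta_1\vartheta_1^*\Sigma_0^{-1}$. Then $zI_n-\theta$ is invertible for every $z\in\mathbb C_+$, the potential $v$ is locally summable, and the Weyl function $\varphi$ of the system exists and is given by $$\varphi(z)=-\mathrm i\,\vartheta_2^*\Sigma_0^{-1}(zI_n-\theta)^{-1}\vartheta_1\qquad(z\in\mathbb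 C_+).$$ -/

import Mathlib

open scoped Matrix ComplexOrder Topology

namespace DiracSystem

noncomputable section

/-- The open upper half-plane `ℂ₊`. -/
def upperHalf : Set ℂ := {z | 0 < z.im}

/-- The signature matrix `j = diag (I_{m₁}, -I_{m₂})`. -/
def signature (m₁ m₂ : ℕ) : Matrix (Fin m₁ ⊕ Fin m₂) (Fin m₁ ⊕ Fin m₂) ℂ :=
  Matrix.fromBlocks 1 0 0 (-1)

/-- The matrix `V = [0, v; v*, 0]`. -/
def potentialMatrix {m₁ m₂ : ℕ} (v : Matrix (Fin m₁) (Fin m₂) ℂ) :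
    Matrix (Fin m₁ ⊕ Fin m₂) (Fin m₁ ⊕ Fin m₂) ℂ :=
  Matrix.fromBlocks 0 v vᴴ 0

/-- The coefficient `i (z j + j V(x))` of the Dirac system `y' = i (z j + j V(x)) y`. -/
def coefficient {m₁ m₂ : ℕ} (v : ℝ → Matrix (Fin m₁) (Fin m₂) ℂ) (x : ℝ) (z : ℂ) :
    Matrix (Fin m₁ ⊕ Fin m₂) (Fin m₁ ⊕ Fin m₂) ℂ :=
  Complex.I • (z • signature m₁ m₂ + signature m₁ m₂ * potentialMatrix (v x))

/-- The potential is measurable and summable on all finite intervals `[0, l]`. -/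
def LocallySummable {m₁ m₂ : ℕ} (v : ℝ → Matrix (Fin m₁) (Fin m₂) ℂ) : Prop :=
  ∀ i k, MeasureTheory.LocallyIntegrableOn (fun x => v x i k) (Set.Ici 0)

/-- `u` is the fundamental solution on `[0, ∞)` of the Dirac system with potential `v`, normalized
by `u(0, z) = I_m`. The initial value problem is written in its integrated (Carathéodory) form:
`u(·, z)` is locally absolutely continuous, the equation holds almost everywhere, and
`u(0, z) = I_m`. -/
structure IsFundamentalSolution {m₁ m₂ : ℕ} (v : ℝ → Matrix (Fin m₁) (Fin m₂) ℂ)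
    (u : ℝ → ℂ → Matrix (Fin m₁ ⊕ Fin m₂) (Fin m₁ ⊕ Fin m₂) ℂ) : Prop where
  intervalIntegrable : ∀ z : ℂ, ∀ x : ℝ, 0 ≤ x → ∀ i k,
    IntervalIntegrable (fun t => (coefficient v t z * u t z) i k) MeasureTheory.volume 0 x
  integral_eq : ∀ z : ℂ, ∀ x : ℝ, 0 ≤ x → ∀ i k,
    u x z i k = (1 : Matrix (Fin m₁ ⊕ Fin m₂) (Fin m₁ ⊕ Fin m₂) ℂ) i k +
      ∫ t in (0 : ℝ)..x, (coefficient v t z * u t z) i k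

/-- Nonsingular `m × m₁` matrix functions with property-`j`: meromorphic in `ℂ₊`, with
`P* P > 0` and `P* j P ≥ 0` in `ℂ₊` outside a discrete set. -/
structure HasPropertyJ {m₁ m₂ : ℕ} (P : ℂ → Matrix (Fin m₁ ⊕ Fin m₂) (Fin m₁) ℂ) : Prop where
  meromorphic : ∀ i k, MeromorphicOn (fun z => P z i k) upperHalf
  nonsingular : ∀ᶠ z in Filter.codiscreteWithin upperHalf, ((P z)ᴴ * P z).PosDef
  nonneg : ∀ᶠ z in Filter.codiscreteWithin upperHalf,
    ((P z)ᴴ * signature m₁ m₂ * P z).PosSemidef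

/-- The linear fractional expression `[0 I] U⁻¹ Q ([I 0] U⁻¹ Q)⁻¹`. -/
def moebius {m₁ m₂ : ℕ} (U : Matrix (Fin m₁ ⊕ Fin m₂) (Fin m₁ ⊕ Fin m₂) ℂ)
    (Q : Matrix (Fin m₁ ⊕ Fin m₂) (Fin m₁) ℂ) : Matrix (Fin m₂) (Fin m₁) ℂ :=
  (Matrix.fromCols (0 : Matrix (Fin m₂) (Fin m₁) ℂ) (1 : Matrix (Fin m₂) (Fin m₂) ℂ) * U⁻¹ * Q) *
    (Matrix.fromCols (1 : Matrix (Fin m₁) (Fin m₁) ℂ) (0 : Matrix (Fin m₁) (Fin m₂) ℂ) *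
      U⁻¹ * Q)⁻¹

/-- The set `N(x, z)` of values at `x, z` of the matrix functions
`[0 I] u(x, ·)⁻¹ P ([I 0] u(x, ·)⁻¹ P)⁻¹`, where `P` runs over the nonsingular matrix functions
with property-`j`. Since `P` is controlled only outside a discrete set, the value at `z` is that of
the function with its removable singularities removed, i.e. the limit along `ζ → z`, `ζ ≠ z`. -/
def moebiusSet {m₁ m₂ : ℕ} (u : ℝ → ℂ → Matrix (Fin m₁ ⊕ Fin m₂) (Fin m₁ ⊕ Fin m₂) ℂ)
    (x : ℝ) (z : ℂ) : Set (Matrix (Fin m₂) (Fin m₁) ℂ) :=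
  {ψ | ∃ P : ℂ → Matrix (Fin m₁ ⊕ Fin m₂) (Fin m₁) ℂ, HasPropertyJ P ∧
    Filter.Tendsto (fun ζ => moebius (u x ζ) (P ζ)) (𝓝[≠] z) (𝓝 ψ)}

/-- `φ` is the Weyl function of the Dirac system on `[0, ∞)` with locally summable potential `v`:
for the fundamental solution `u` and every `z ∈ ℂ₊`, `φ(z)` is the only common point of the sets
`N(x, z)`, `0 ≤ x < ∞`. -/
def IsWeylFunction {m₁ m₂ : ℕ} (v : ℝ → Matrix (Fin m₁) (Fin m₂) ℂ)
    (φ : ℂ → Matrix (Fin m₂) (Fin m₁) ℂ) : Prop :=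
  LocallySummable v ∧
    ∃ u : ℝ → ℂ → Matrix (Fin m₁ ⊕ Fin m₂) (Fin m₁ ⊕ Fin m₂) ℂ,
      IsFundamentalSolution v u ∧
        ∀ z ∈ upperHalf, ⋂ x ∈ Set.Ici (0 : ℝ), moebiusSet u x z = {φ z}

/-- `Λ(x) = [e^{-ixα} ϑ₁, e^{ixα} ϑ₂]`. -/
def bigLambda {n m₁ m₂ : ℕ} (α : Matrix (Fin n) (Fin n) ℂ) (ϑ₁ : Matrix (Fin n) (Fin m₁) ℂ)
    (ϑ₂ : Matrix (Fin n) (Fin m₂) ℂ) (x : ℝ) : Matrix (Fin n) (Fin m₁ ⊕ Fin m₂) ℂ :=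
  Matrix.fromCols (NormedSpace.exp ((-(Complex.I * (x : ℂ))) • α) * ϑ₁)
    (NormedSpace.exp ((Complex.I * (x : ℂ)) • α) * ϑ₂)

/-- `Σ(x) = Σ₀ + ∫₀ˣ Λ(t) Λ(t)* dt` (entrywise integral). -/
def bigSigma {n m₁ m₂ : ℕ} (α S₀ : Matrix (Fin n) (Fin n) ℂ) (ϑ₁ : Matrix (Fin n) (Fin m₁) ℂ)
    (ϑ₂ : Matrix (Fin n) (Fin m₂) ℂ) (x : ℝ) : Matrix (Fin n) (Fin n) ℂ :=
  S₀ + Matrix.of fun i k =>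
    ∫ t in (0 : ℝ)..x, (bigLambda α ϑ₁ ϑ₂ t * (bigLambda α ϑ₁ ϑ₂ t)ᴴ) i k

/-- `v` is the generalized pseudo-exponential potential on `[0, ∞)` generated by the parameter
matrices `α`, `S₀ = Σ₀`, `ϑ₁`, `ϑ₂`. -/
structure IsGeneralizedPseudoExponential {n m₁ m₂ : ℕ} (v : ℝ → Matrix (Fin m₁) (Fin m₂) ℂ)
    (α S₀ : Matrix (Fin n) (Fin n) ℂ) (ϑ₁ : Matrix (Fin n) (Fin m₁) ℂ)
    (ϑ₂ : Matrix (Fin n) (Fin m₂) ℂ) : Prop where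
  posDef : S₀.PosDef
  identity : α * S₀ - S₀ * αᴴ = Complex.I • (ϑ₁ * ϑ₁ᴴ - ϑ₂ * ϑ₂ᴴ)
  potential_eq : ∀ x : ℝ, 0 ≤ x → v x =
    (-2 * Complex.I) • (ϑ₁ᴴ * NormedSpace.exp ((Complex.I * (x : ℂ)) • αᴴ) *
      (bigSigma α S₀ ϑ₁ ϑ₂ x)⁻¹ * NormedSpace.exp ((Complex.I * (x : ℂ)) • α) * ϑ₂)

/-- `θ = α - i ϑ₁ ϑ₁* Σ₀⁻¹`. -/
def theta {n m₁ : ℕ} (α S₀ : Matrix (Fin n) (Fin n) ℂ) (ϑ₁ : Matrix (Fin n) (Fin m₁) ℂ) :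
    Matrix (Fin n) (Fin n) ℂ :=
  α - Complex.I • (ϑ₁ * ϑ₁ᴴ * S₀⁻¹)

end

end DiracSystem

/-! Write `j` for `signature` and `W(x,z) = I + i j Λ* Σ⁻¹ (z-α)⁻¹ Λ` for `transfer`. The identity
`αΣ - Σα* = i Λ j Λ*` persists for all `x` (`bigSigma_identity`), and it makes `W` a Darboux matrix:
`W' = i(zj + jV)W - W·izj` (`hasEntryDeriv_transfer`). Hence `u = W(x,z) e^{ixzj} W(0,z)⁻¹` whenever
`z` is an eigenvalue of neither `α` nor `α*`.

Existence. The same identity gives `W* j W ≥ j` in the upper half-plane, so `P = W(x,·)[I; 0]` has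
property-`j`. For this `P`, `u⁻¹P = e^{-ixz} W(0,z)[I; 0]`. The scalar cancels in the linear
fractional expression, whose value `W₂₁(0,z) W₁₁(0,z)⁻¹` no longer depends on `x`. Inverting `W₁₁ =
I + iϑ₁*Σ₀⁻¹(z-α)⁻¹ϑ₁` replaces `α` by `θ` in the resolvent and yields the stated formula
(`moebius_explicitSolution`).

Uniqueness. Solutions satisfy `(y* j y)' = -2 Im z · y* y`. Any value `ψ` of the linear fractional
expression at `x` makes `y* j y ≥ 0` at `x` for the solution starting at `[ξ; ψξ]`
(`signatureForm_moebius_nonneg`). Comparing two such solutions gives `x · Im z · |ψξ - φξ|² ≤ 2|ξ|²`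
(`mul_sqNorm_sub_le`), and `x → ∞` forces `ψ = φ`.

The finitely many exceptional `z` cause no trouble. There `u` comes from the Peano–Baker series, and
the values at `z` are limits over punctured neighbourhoods, where the explicit `u` is available. -/

namespace DiracSystem

/-! ### Entrywise calculus of matrix functions, independent of any matrix norm. -/

section EntryDeriv

variable {p q r : Type*}

/-- The matrix function `A` of a real variable has, entry by entry, the derivative `A'` at `t`. -/
def HasEntryDeriv (A : ℝ → Matrix p q ℂ) (A' : Matrix p q ℂ) (t : ℝ) : Prop :=
  ∀ i k, HasDerivAt (fun s => A s i k) (A' i k) t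

theorem hasEntryDeriv_const (A : Matrix p q ℂ) (t : ℝ) : HasEntryDeriv (fun _ => A) 0 t :=
  fun _ _ => hasDerivAt_const _ _

namespace HasEntryDeriv

variable {A B : ℝ → Matrix p q ℂ} {A' B' : Matrix p q ℂ} {t : ℝ}

theorem congr_deriv (hA : HasEntryDeriv A A' t) (h : A' = B') : HasEntryDeriv A B' t := h ▸ hA

theorem add (hA : HasEntryDeriv A A' t) (hB : HasEntryDeriv B B' t) :
    HasEntryDeriv (fun s => A s + B s) (A' + B') t :=
  fun i k => (hA i k).add (hB i k)

theorem sub (hA : HasEntryDeriv A A' t) (hB : HasEntryDeriv B B' t) :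
    HasEntryDeriv (fun s => A s - B s) (A' - B') t :=
  fun i k => (hA i k).sub (hB i k)

theorem const_smul (c : ℂ) (hA : HasEntryDeriv A A' t) :
    HasEntryDeriv (fun s => c • A s) (c • A') t :=
  fun i k => (hA i k).const_mul c

theorem conjTranspose (hA : HasEntryDeriv A A' t) :
    HasEntryDeriv (fun s => (A s)ᴴ) A'ᴴ t :=
  fun i k => (hA k i).star

theorem mul [Fintype q] {C : ℝ → Matrix q r ℂ} {C' : Matrix q r ℂ}
    (hA : HasEntryDeriv A A' t) (hC : HasEntryDeriv C C' t) :
    HasEntryDeriv (fun s => A s * C s) (A' * C t + A t * C') t := by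
  intro i k
  simp only [Matrix.mul_apply, Matrix.add_apply, ← Finset.sum_add_distrib]
  exact HasDerivAt.fun_sum fun l _ => (hA i l).mul (hC l k)

theorem const_mul [Fintype p] (C : Matrix r p ℂ) (hA : HasEntryDeriv A A' t) :
    HasEntryDeriv (fun s => C * A s) (C * A') t := by
  simpa using (hasEntryDeriv_const C t).mul hA

theorem mul_const [Fintype q] (C : Matrix q r ℂ) (hA : HasEntryDeriv A A' t) :
    HasEntryDeriv (fun s => A s * C) (A' * C) t := by
  simpa using hA.mul (hasEntryDeriv_const C t)

end HasEntryDeriv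

theorem differentiableAt_det [Fintype p] [DecidableEq p] {A : ℝ → Matrix p p ℂ} {t : ℝ}
    (hA : ∀ i k, DifferentiableAt ℝ (fun s => A s i k) t) :
    DifferentiableAt ℝ (fun s => (A s).det) t := by
  simp only [Matrix.det_apply']
  exact DifferentiableAt.fun_sum fun σ _ =>
    (differentiableAt_const _).mul (DifferentiableAt.fun_finsetProd fun i _ => hA _ _)

/-- Cramer's rule shows that the entries of the inverse are differentiable; the value of the
derivative then follows by differentiating `A⁻¹ A = 1`. -/
theorem HasEntryDeriv.inv [Fintype p] [DecidableEq p] {A : ℝ → Matrix p p ℂ} {A' : Matrix p p ℂ}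
    {t : ℝ} (hA : HasEntryDeriv A A' t) (ht : IsUnit (A t)) :
    HasEntryDeriv (fun s => (A s)⁻¹) (-((A t)⁻¹ * A' * (A t)⁻¹)) t := by
  have hdet : IsUnit (A t).det := (Matrix.isUnit_iff_isUnit_det _).1 ht
  have hdiff : ∀ i k, DifferentiableAt ℝ (fun s => (A s)⁻¹ i k) t := by
    intro i k
    simp only [Matrix.inv_def, Ring.inverse_eq_inv', Matrix.smul_apply, smul_eq_mul,
      Matrix.adjugate_apply]
    refine ((differentiableAt_det fun i k => (hA i k).differentiableAt).inv hdet.ne_zero).mul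
      (differentiableAt_det fun a b => ?_)
    -- An adjugate entry is the determinant of `A` with row `k` replaced by a constant row.
    by_cases h : a = k
    · subst h; simp
    · simpa [Matrix.updateRow_ne h] using (hA a b).differentiableAt
  set D : Matrix p p ℂ := Matrix.of fun i k => deriv (fun s => (A s)⁻¹ i k) t with hD
  have hinv : HasEntryDeriv (fun s => (A s)⁻¹) D t := fun i k => (hdiff i k).hasDerivAt
  have hone : HasEntryDeriv (fun s => (A s)⁻¹ * A s) 0 t := by
    have hev : ∀ᶠ s in 𝓝 t, IsUnit (A s).det := by
      have := (differentiableAt_det fun i k => (hA i k).differentiableAt).continuousAt.eventually_ne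
        hdet.ne_zero
      exact this.mono fun s hs => isUnit_iff_ne_zero.2 hs
    intro i k
    refine (hasDerivAt_const t ((1 : Matrix p p ℂ) i k)).congr_of_eventuallyEq ?_
    filter_upwards [hev] with s hs
    rw [Matrix.nonsing_inv_mul _ hs]
  have hsum : D * A t + (A t)⁻¹ * A' = 0 := by
    ext i k
    exact (hinv.mul hA i k).unique (hone i k)
  refine hinv.congr_deriv ?_
  have : (D * A t + (A t)⁻¹ * A') * (A t)⁻¹ = 0 := by rw [hsum, zero_mul]
  rw [add_mul, Matrix.mul_assoc D, Matrix.mul_nonsing_inv _ hdet, mul_one] at this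
  exact eq_neg_of_add_eq_zero_left this

end EntryDeriv

section Exp

variable {p : Type*} [Fintype p] [DecidableEq p]

open scoped Matrix.Norms.Operator in
theorem hasEntryDeriv_exp (c : ℂ) (A : Matrix p p ℂ) (t : ℝ) :
    HasEntryDeriv (fun s : ℝ => NormedSpace.exp ((c * (s : ℂ)) • A))
      (c • (A * NormedSpace.exp ((c * (t : ℂ)) • A))) t := by
  intro i k
  have h := (hasDerivAt_exp_smul_const' (𝕂 := ℂ) A (c * (t : ℂ)))
  have h2 : HasDerivAt (fun s : ℝ => c * (s : ℂ)) c t := by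
    simpa using (Complex.ofRealCLM.hasDerivAt (x := t)).const_mul c
  have h3 := h.scomp t h2
  let ev : Matrix p p ℂ →L[ℂ] ℂ := LinearMap.toContinuousLinearMap (Matrix.entryLinearMap ℂ ℂ i k)
  exact (ev.restrictScalars ℝ).hasFDerivAt.comp_hasDerivAt t h3

end Exp

/-! ### Global solvability of linear equations by the Peano–Baker series. -/

section LinearODE

variable {E : Type*} [NormedAddCommGroup E] [NormedSpace ℝ E]

/-- The Picard iterates of the linear equation `y' = A(t) y`, `y(0) = y₀`: the `k`-th term of the
Peano–Baker series. -/
noncomputable def peanoBakerTerm (A : ℝ → E →L[ℝ] E) (y₀ : E) : ℕ → ℝ → E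
  | 0 => fun _ => y₀
  | k + 1 => fun t => ∫ s in (0 : ℝ)..t, A s (peanoBakerTerm A y₀ k s)

theorem continuous_peanoBakerTerm [CompleteSpace E] {A : ℝ → E →L[ℝ] E} (hA : Continuous A)
    (y₀ : E) (k : ℕ) : Continuous (peanoBakerTerm A y₀ k) := by
  induction k with
  | zero => exact continuous_const
  | succ k ih =>
    exact intervalIntegral.continuous_primitive
      (fun a b => (hA.clm_apply ih).intervalIntegrable a b) 0

/-- Each integration turns `s ^ k / k!` into `t ^ (k+1) / (k+1)!`, so the series is dominated by an
exponential series on every bounded interval. -/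
theorem norm_peanoBakerTerm_le {A : ℝ → E →L[ℝ] E} {T M : ℝ}
    (hM : ∀ t ∈ Set.Icc 0 T, ‖A t‖ ≤ M) (y₀ : E) (k : ℕ) {t : ℝ}
    (ht : t ∈ Set.Icc 0 T) :
    ‖peanoBakerTerm A y₀ k t‖ ≤ ‖y₀‖ * ((M * t) ^ k / k.factorial) := by
  have hM0 : 0 ≤ M := (norm_nonneg _).trans (hM t ht)
  induction k generalizing t with
  | zero => simp [peanoBakerTerm]
  | succ k ih =>
    have hbound : ∀ s ∈ Set.Ioc 0 t, ‖A s (peanoBakerTerm A y₀ k s)‖ ≤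
        M * (‖y₀‖ * ((M * s) ^ k / k.factorial)) := by
      intro s hs
      have hs' : s ∈ Set.Icc 0 T := ⟨hs.1.le, hs.2.trans ht.2⟩
      exact ((A s).le_opNorm _).trans
        (mul_le_mul (hM s hs') (ih hs') (norm_nonneg _) hM0)
    have h := intervalIntegral.norm_integral_le_of_norm_le (μ := MeasureTheory.volume) ht.1
      (Filter.Eventually.of_forall hbound) (Continuous.intervalIntegrable (by fun_prop) _ _)
    refine h.trans (le_of_eq ?_)
    have : ∀ s : ℝ, M * (‖y₀‖ * ((M * s) ^ k / k.factorial)) =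
        (M * ‖y₀‖ * M ^ k / k.factorial) * s ^ k := fun s => by rw [mul_pow]; ring
    simp only [this, intervalIntegral.integral_const_mul, integral_pow, Nat.factorial_succ]
    have h1 : (k.factorial : ℝ) ≠ 0 := by positivity
    have h2 : (k : ℝ) + 1 ≠ 0 := by positivity
    push_cast
    field_simp
    ring

/-- A linear equation with continuous coefficients has a solution on the whole half-line. -/
theorem exists_linear_integral_solution [CompleteSpace E] {A : ℝ → E →L[ℝ] E} (hA : Continuous A)
    (y₀ : E) : ∃ y : ℝ → E, ContinuousOn y (Set.Ici 0) ∧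
      ∀ t, 0 ≤ t → y t = y₀ + ∫ s in (0 : ℝ)..t, A s (y s) := by
  have hbd : ∀ T : ℝ, ∃ M, ∀ t ∈ Set.Icc 0 T, ‖A t‖ ≤ M := fun T =>
    isCompact_Icc.exists_bound_of_continuousOn hA.continuousOn
  have hkey : ∀ T : ℝ, 0 ≤ T → ∃ b : ℕ → ℝ, Summable b ∧ ∀ k, ∀ t ∈ Set.Icc 0 T,
      ‖peanoBakerTerm A y₀ k t‖ ≤ b k := by
    intro T hT
    obtain ⟨M, hM⟩ := hbd T
    have hM0 : 0 ≤ M := (norm_nonneg _).trans (hM 0 ⟨le_rfl, hT⟩)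
    refine ⟨fun k => ‖y₀‖ * ((M * T) ^ k / k.factorial),
      (Real.summable_pow_div_factorial _).mul_left _, fun k t ht => ?_⟩
    refine (norm_peanoBakerTerm_le hM y₀ k ht).trans ?_
    have := mul_nonneg hM0 ht.1
    beta_reduce
    gcongr
    exact ht.2
  have hsum : ∀ t, 0 ≤ t → Summable fun k => peanoBakerTerm A y₀ k t := by
    intro t ht
    obtain ⟨b, hb, hle⟩ := hkey t ht
    exact Summable.of_norm_bounded hb fun k => hle k t ⟨ht, le_rfl⟩
  refine ⟨fun t => ∑' k, peanoBakerTerm A y₀ k t, ?_, ?_⟩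
  · intro t ht
    -- The extra unit makes `[0, t + 1]` a neighbourhood of `t` within `[0, ∞)`.
    obtain ⟨b, hb, hle⟩ := hkey (t + 1) (by have : (0 : ℝ) ≤ t := ht; linarith)
    have hc : ContinuousOn (fun t => ∑' k, peanoBakerTerm A y₀ k t) (Set.Icc 0 (t + 1)) :=
      continuousOn_tsum (fun k => (continuous_peanoBakerTerm hA y₀ k).continuousOn) hb hle
    refine (hc t ⟨ht, by linarith⟩).mono_of_mem_nhdsWithin ?_
    rw [← Set.Ici_inter_Iic]
    exact Filter.inter_mem self_mem_nhdsWithin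
      (mem_nhdsWithin_of_mem_nhds (Iic_mem_nhds (by linarith)))
  · intro t ht
    obtain ⟨b, hb, hle⟩ := hkey t ht
    obtain ⟨M, hM⟩ := hbd t
    have hM0 : 0 ≤ M := (norm_nonneg _).trans (hM 0 ⟨le_rfl, ht⟩)
    have hIoc : ∀ s, s ∈ Set.uIoc 0 t → s ∈ Set.Icc 0 t := fun s hs =>
      Set.Ioc_subset_Icc_self (Set.uIoc_of_le ht ▸ hs)
    have hint : HasSum (fun k => peanoBakerTerm A y₀ (k + 1) t)
        (∫ s in (0 : ℝ)..t, A s (∑' k, peanoBakerTerm A y₀ k s)) := by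
      refine intervalIntegral.hasSum_integral_of_dominated_convergence (fun k _ => M * b k)
        (fun k => (hA.clm_apply (continuous_peanoBakerTerm hA y₀ k)).aestronglyMeasurable)
        (fun k => Filter.Eventually.of_forall fun s hs => ?_)
        (Filter.Eventually.of_forall fun s _ => hb.mul_left M) (by simp)
        (Filter.Eventually.of_forall fun s hs => ?_)
      · exact ((A s).le_opNorm _).trans (mul_le_mul (hM s (hIoc s hs)) (hle k s (hIoc s hs))
          (norm_nonneg _) hM0)
      · exact (A s).hasSum (hsum s (hIoc s hs).1).hasSum
    have := (hsum t ht).tsum_eq_zero_add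
    simp only [this, hint.tsum_eq]
    rfl

end LinearODE

section MatrixODE

variable {p : Type*} [Fintype p] [DecidableEq p]

/-- A linear matrix equation with continuous coefficients has a fundamental solution on the
half-line. -/
theorem exists_matrix_integral_solution {A : ℝ → Matrix p p ℂ}
    (hA : ∀ i k, Continuous fun t => A t i k) :
    ∃ U : ℝ → Matrix p p ℂ, (∀ i k, ContinuousOn (fun t => U t i k) (Set.Ici 0)) ∧
      ∀ t, 0 ≤ t → ∀ i k, U t i k = (1 : Matrix p p ℂ) i k +
        ∫ s in (0 : ℝ)..t, (A s * U s) i k := by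
  let L : ℝ → (p → ℂ) →L[ℝ] (p → ℂ) := fun t =>
    (LinearMap.toContinuousLinearMap (A t).mulVecLin).restrictScalars ℝ
  have hLapp : ∀ t y, L t y = A t *ᵥ y := fun _ _ => rfl
  have hL : Continuous L := by
    refine continuous_clm_apply.2 fun y => continuous_pi fun i => ?_
    simp only [hLapp, Matrix.mulVec, dotProduct]
    exact continuous_finsetSum _ fun k _ => (hA i k).mul continuous_const
  choose y hyc hy using fun k : p => exists_linear_integral_solution hL ((1 : Matrix p p ℂ).col k)
  have hcomp : ∀ i k, ContinuousOn (fun t => y k t i) (Set.Ici 0) := fun i k =>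
    (continuous_apply i).comp_continuousOn (hyc k)
  refine ⟨fun t => Matrix.of fun i k => y k t i, hcomp, fun t ht i k => ?_⟩
  have hcont : ContinuousOn (fun s => L s (y k s)) (Set.uIcc 0 t) := by
    rw [Set.uIcc_of_le ht]
    exact hL.continuousOn.clm_apply ((hyc k).mono Set.Icc_subset_Ici_self)
  have := (ContinuousLinearMap.proj (R := ℝ) (φ := fun _ : p => ℂ) i).intervalIntegral_comp_comm
    (μ := MeasureTheory.volume) hcont.intervalIntegrable
  have h2 := congrFun (hy k t ht) i
  simp only [Pi.add_apply] at h2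
  simp only [Matrix.of_apply]
  rw [h2]
  congr 1
  exact this.symm

end MatrixODE

/-! ### The signature matrix and the coefficient of the system. -/

section Signature

variable {m₁ m₂ : ℕ}

@[simp] theorem signature_mul_signature : signature m₁ m₂ * signature m₁ m₂ = 1 := by
  simp [signature, Matrix.fromBlocks_multiply]

@[simp] theorem conjTranspose_signature : (signature m₁ m₂)ᴴ = signature m₁ m₂ := by
  simp [signature, Matrix.fromBlocks_conjTranspose]

/-- The potential drops out because `V` is Hermitian and `j² = 1`. This is the infinitesimal form of
the energy identity. -/
theorem conjTranspose_coefficient_mul_signature (v : ℝ → Matrix (Fin m₁) (Fin m₂) ℂ) (x : ℝ)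
    (z : ℂ) : (coefficient v x z)ᴴ * signature m₁ m₂ + signature m₁ m₂ * coefficient v x z =
      (-2 * z.im : ℂ) • 1 := by
  have hz : -(Complex.I * (starRingEnd ℂ) z) + Complex.I * z = -2 * z.im := by
    apply Complex.ext <;> simp; ring
  have hz' : (-(Complex.I * (starRingEnd ℂ) z) + Complex.I * z) •
      (1 : Matrix (Fin m₁ ⊕ Fin m₂) (Fin m₁ ⊕ Fin m₂) ℂ) = (-2 * z.im : ℂ) • 1 := by rw [hz]
  rw [← hz', coefficient, signature, potentialMatrix]
  rw [← Matrix.fromBlocks_one]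
  simp only [Matrix.conjTranspose_smul, Matrix.fromBlocks_conjTranspose, Matrix.fromBlocks_smul,
    Matrix.fromBlocks_add, Matrix.fromBlocks_multiply]
  congr 1 <;> simp [add_smul, smul_smul]

end Signature

/-! ### The matrix functions `Λ` and `Σ`. -/

section Parameters

variable {n m₁ m₂ : ℕ} (α S₀ : Matrix (Fin n) (Fin n) ℂ) (ϑ₁ : Matrix (Fin n) (Fin m₁) ℂ)
  (ϑ₂ : Matrix (Fin n) (Fin m₂) ℂ)

theorem hasEntryDeriv_bigLambda (x : ℝ) : HasEntryDeriv (bigLambda α ϑ₁ ϑ₂)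
    ((-Complex.I) • (α * bigLambda α ϑ₁ ϑ₂ x * signature m₁ m₂)) x := by
  have h₁ := (hasEntryDeriv_exp (-Complex.I) α x).mul_const ϑ₁
  have h₂ := (hasEntryDeriv_exp Complex.I α x).mul_const ϑ₂
  have e : (-Complex.I) • (α * bigLambda α ϑ₁ ϑ₂ x * signature m₁ m₂) = Matrix.fromCols
      ((-Complex.I) • (α * NormedSpace.exp ((-Complex.I * (x : ℂ)) • α)) * ϑ₁)
      (Complex.I • (α * NormedSpace.exp ((Complex.I * (x : ℂ)) • α)) * ϑ₂) := by
    simp only [bigLambda, signature, Matrix.mul_fromCols, Matrix.fromCols_mul_fromBlocks]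
    ext i (k | k) <;> simp [Matrix.mul_assoc]
  rw [e]
  rintro i (k | k)
  · simpa [bigLambda] using h₁ i k
  · simpa [bigLambda] using h₂ i k

theorem continuous_bigLambda (i : Fin n) (k : Fin m₁ ⊕ Fin m₂) :
    Continuous fun x => bigLambda α ϑ₁ ϑ₂ x i k :=
  continuous_iff_continuousAt.2 fun x => (hasEntryDeriv_bigLambda α ϑ₁ ϑ₂ x i k).continuousAt

theorem hasEntryDeriv_bigSigma (x : ℝ) : HasEntryDeriv (bigSigma α S₀ ϑ₁ ϑ₂)
    (bigLambda α ϑ₁ ϑ₂ x * (bigLambda α ϑ₁ ϑ₂ x)ᴴ) x := by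
  intro i k
  have hc : Continuous fun t => (bigLambda α ϑ₁ ϑ₂ t * (bigLambda α ϑ₁ ϑ₂ t)ᴴ) i k := by
    simp only [Matrix.mul_apply, Matrix.conjTranspose_apply]
    exact continuous_finsetSum _ fun l _ => (continuous_bigLambda α ϑ₁ ϑ₂ i l).mul
      (continuous_bigLambda α ϑ₁ ϑ₂ k l).star
  exact (hc.integral_hasStrictDerivAt 0 x).hasDerivAt.const_add _

@[simp] theorem bigSigma_zero : bigSigma α S₀ ϑ₁ ϑ₂ 0 = S₀ := by
  ext i k; simp [bigSigma]

@[simp] theorem bigLambda_zero : bigLambda α ϑ₁ ϑ₂ 0 = Matrix.fromCols ϑ₁ ϑ₂ := by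
  simp [bigLambda, NormedSpace.exp_zero]

theorem eq_of_hasEntryDeriv_zero {p q : Type*} {A : ℝ → Matrix p q ℂ}
    (h : ∀ x, HasEntryDeriv A 0 x) (x y : ℝ) : A x = A y := by
  ext i k
  exact is_const_of_deriv_eq_zero (fun t => (h t i k).differentiableAt)
    (fun t => (h t i k).deriv) x y

variable {α S₀ ϑ₁ ϑ₂}

theorem isHermitian_bigSigma (hS : S₀.IsHermitian) (x : ℝ) :
    (bigSigma α S₀ ϑ₁ ϑ₂ x).IsHermitian := by
  have h := eq_of_hasEntryDeriv_zero (A := fun x => (bigSigma α S₀ ϑ₁ ϑ₂ x)ᴴ -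
    bigSigma α S₀ ϑ₁ ϑ₂ x) (fun x => ((hasEntryDeriv_bigSigma α S₀ ϑ₁ ϑ₂ x).conjTranspose.sub
      (hasEntryDeriv_bigSigma α S₀ ϑ₁ ϑ₂ x)).congr_deriv (by simp)) x 0
  simp only [bigSigma_zero, hS.eq, sub_self] at h
  exact sub_eq_zero.1 h

/-- By `Λ' = -iαΛj` and `j² = 1`, both sides have derivative `αΛΛ* - ΛΛ*α*`; they agree at `0` by
hypothesis. -/
theorem bigSigma_identity
    (hid : α * S₀ - S₀ * αᴴ = Complex.I • (ϑ₁ * ϑ₁ᴴ - ϑ₂ * ϑ₂ᴴ)) (x : ℝ) :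
    α * bigSigma α S₀ ϑ₁ ϑ₂ x - bigSigma α S₀ ϑ₁ ϑ₂ x * αᴴ =
      Complex.I • (bigLambda α ϑ₁ ϑ₂ x * signature m₁ m₂ * (bigLambda α ϑ₁ ϑ₂ x)ᴴ) := by
  have h := eq_of_hasEntryDeriv_zero (A := fun x => α * bigSigma α S₀ ϑ₁ ϑ₂ x -
    bigSigma α S₀ ϑ₁ ϑ₂ x * αᴴ -
      Complex.I • (bigLambda α ϑ₁ ϑ₂ x * signature m₁ m₂ * (bigLambda α ϑ₁ ϑ₂ x)ᴴ)) (fun x => by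
    have hSig := hasEntryDeriv_bigSigma α S₀ ϑ₁ ϑ₂ x
    have hLam := hasEntryDeriv_bigLambda α ϑ₁ ϑ₂ x
    refine (((hSig.const_mul α).sub (hSig.mul_const αᴴ)).sub
      (((hLam.mul_const (signature m₁ m₂)).mul hLam.conjTranspose).const_smul _)).congr_deriv ?_
    simp only [Matrix.conjTranspose_smul, Matrix.conjTranspose_mul, conjTranspose_signature,
      smul_add, Matrix.smul_mul, Matrix.mul_smul, smul_smul, Matrix.mul_assoc]
    simp only [← Matrix.mul_assoc (signature m₁ m₂), signature_mul_signature, Matrix.one_mul]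
    simp [sub_eq_add_neg]) x 0
  have h0 : Matrix.fromCols ϑ₁ ϑ₂ * signature m₁ m₂ * (Matrix.fromCols ϑ₁ ϑ₂)ᴴ =
      ϑ₁ * ϑ₁ᴴ - ϑ₂ * ϑ₂ᴴ := by
    rw [signature, Matrix.fromCols_mul_fromBlocks,
      Matrix.conjTranspose_fromCols_eq_fromRows_conjTranspose, Matrix.fromCols_mul_fromRows]
    simp [sub_eq_add_neg]
  simp only [bigSigma_zero, bigLambda_zero, h0, hid, sub_self] at h
  exact sub_eq_zero.1 h

theorem posDef_bigSigma (hS : S₀.PosDef) {x : ℝ} (hx : 0 ≤ x) :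
    (bigSigma α S₀ ϑ₁ ϑ₂ x).PosDef := by
  refine Matrix.PosDef.of_dotProduct_mulVec_pos (isHermitian_bigSigma hS.isHermitian x) ?_
  intro ξ hξ
  -- As a one-column matrix, `ξ` turns the quadratic form into an entry of a product, to which the
  -- entrywise calculus applies.
  let C : Matrix (Fin n) (Fin 1) ℂ := Matrix.of fun i _ => ξ i
  have hC : ∀ M : Matrix (Fin n) (Fin n) ℂ, star ξ ⬝ᵥ M *ᵥ ξ = (Cᴴ * M * C) 0 0 := by
    intro M
    rw [Matrix.mul_assoc]
    simp [C, Matrix.mul_apply, dotProduct, Matrix.mulVec]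
  have hpsd : ∀ t, 0 ≤ (Cᴴ * (bigLambda α ϑ₁ ϑ₂ t * (bigLambda α ϑ₁ ϑ₂ t)ᴴ) * C) 0 0 := fun t =>
    ((Matrix.posSemidef_self_mul_conjTranspose _).conjTranspose_mul_mul_same C).diag_nonneg
  have hd : ∀ t, HasDerivAt (fun t => ((Cᴴ * bigSigma α S₀ ϑ₁ ϑ₂ t * C) 0 0).re)
      ((Cᴴ * (bigLambda α ϑ₁ ϑ₂ t * (bigLambda α ϑ₁ ϑ₂ t)ᴴ) * C) 0 0).re t := fun t =>
    Complex.reCLM.hasFDerivAt.comp_hasDerivAt t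
      ((((hasEntryDeriv_bigSigma α S₀ ϑ₁ ϑ₂ t).const_mul Cᴴ).mul_const C) 0 0)
  have hmono : Monotone fun t => ((Cᴴ * bigSigma α S₀ ϑ₁ ϑ₂ t * C) 0 0).re :=
    monotone_of_hasDerivAt_nonneg hd fun t => (Complex.nonneg_iff.1 (hpsd t)).1
  have h0 := hmono hx
  simp only [bigSigma_zero] at h0
  have h1 := hS.dotProduct_mulVec_pos hξ
  rw [hC] at h1 ⊢
  have him : ((Cᴴ * bigSigma α S₀ ϑ₁ ϑ₂ x * C) 0 0).im = 0 := by
    have : (Cᴴ * bigSigma α S₀ ϑ₁ ϑ₂ x * C).IsHermitian :=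
      Matrix.isHermitian_conjTranspose_mul_mul C (isHermitian_bigSigma hS.isHermitian x)
    exact Complex.conj_eq_iff_im.1 (this.apply 0 0)
  exact Complex.pos_iff.2 ⟨(Complex.pos_iff.1 h1).1.trans_le h0, him.symm⟩

end Parameters

/-! ### The Darboux matrix and its differential equation. -/

section Transfer

variable {n m₁ m₂ : ℕ} (α S₀ : Matrix (Fin n) (Fin n) ℂ) (ϑ₁ : Matrix (Fin n) (Fin m₁) ℂ)
  (ϑ₂ : Matrix (Fin n) (Fin m₂) ℂ)

/-- The transfer (Darboux) matrix function `I + i j Λ(x)* Σ(x)⁻¹ (z - α)⁻¹ Λ(x)`. -/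
noncomputable def transfer (x : ℝ) (z : ℂ) : Matrix (Fin m₁ ⊕ Fin m₂) (Fin m₁ ⊕ Fin m₂) ℂ :=
  1 + Complex.I • (signature m₁ m₂ * ((bigLambda α ϑ₁ ϑ₂ x)ᴴ * (bigSigma α S₀ ϑ₁ ϑ₂ x)⁻¹) *
    ((z • 1 - α)⁻¹ * bigLambda α ϑ₁ ϑ₂ x))

/-- The generalized pseudo-exponential potential, by its formula on the whole line. -/
noncomputable def pseudoExpPotential (x : ℝ) : Matrix (Fin m₁) (Fin m₂) ℂ :=
  (-2 * Complex.I) • (ϑ₁ᴴ * NormedSpace.exp ((Complex.I * (x : ℂ)) • αᴴ) *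
      (bigSigma α S₀ ϑ₁ ϑ₂ x)⁻¹ * NormedSpace.exp ((Complex.I * (x : ℂ)) • α) * ϑ₂)

variable {α S₀ ϑ₁ ϑ₂}

/-- Multiplying the identity for `Σ` by `Σ⁻¹` on both sides lets `α*` pass through `Σ⁻¹` and become
`α`, which can then meet the resolvent of `α`. -/
theorem conjTranspose_mul_inv_bigSigma (hS : S₀.PosDef)
    (hid : α * S₀ - S₀ * αᴴ = Complex.I • (ϑ₁ * ϑ₁ᴴ - ϑ₂ * ϑ₂ᴴ)) {x : ℝ} (hx : 0 ≤ x) :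
    αᴴ * (bigSigma α S₀ ϑ₁ ϑ₂ x)⁻¹ = (bigSigma α S₀ ϑ₁ ϑ₂ x)⁻¹ * α -
      Complex.I • ((bigSigma α S₀ ϑ₁ ϑ₂ x)⁻¹ * (bigLambda α ϑ₁ ϑ₂ x * signature m₁ m₂ *
        (bigLambda α ϑ₁ ϑ₂ x)ᴴ) * (bigSigma α S₀ ϑ₁ ϑ₂ x)⁻¹) := by
  have hdet : IsUnit (bigSigma α S₀ ϑ₁ ϑ₂ x).det :=
    (Matrix.isUnit_iff_isUnit_det _).1 (posDef_bigSigma hS hx).isUnit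
  rw [← Matrix.smul_mul, ← Matrix.mul_smul, ← bigSigma_identity hid, mul_sub, sub_mul]
  rw [← Matrix.mul_assoc _ α, ← Matrix.mul_assoc _ _ αᴴ, Matrix.nonsing_inv_mul _ hdet,
    Matrix.mul_nonsing_inv_cancel_right _ _ hdet, Matrix.one_mul, sub_sub_cancel]

/-- The derivative of `Λ* Σ⁻¹`. -/
theorem hasEntryDeriv_conjTranspose_bigLambda_mul_inv (hS : S₀.PosDef)
    (hid : α * S₀ - S₀ * αᴴ = Complex.I • (ϑ₁ * ϑ₁ᴴ - ϑ₂ * ϑ₂ᴴ)) {x : ℝ} (hx : 0 ≤ x)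
    {L : Matrix (Fin n) (Fin m₁ ⊕ Fin m₂) ℂ} (hL : bigLambda α ϑ₁ ϑ₂ x = L)
    {B : Matrix (Fin m₁ ⊕ Fin m₂) (Fin n) ℂ} (hB : Lᴴ * (bigSigma α S₀ ϑ₁ ϑ₂ x)⁻¹ = B) :
    HasEntryDeriv (fun x => (bigLambda α ϑ₁ ϑ₂ x)ᴴ * (bigSigma α S₀ ϑ₁ ϑ₂ x)⁻¹)
      (Complex.I • (signature m₁ m₂ * (B * α)) +
        (signature m₁ m₂ * (B * (L * (signature m₁ m₂ * B))) - B * (L * B))) x := by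
  have hu := (posDef_bigSigma (α := α) (ϑ₁ := ϑ₁) (ϑ₂ := ϑ₂) hS hx).isUnit
  have hadj := conjTranspose_mul_inv_bigSigma hS hid hx
  refine ((hasEntryDeriv_bigLambda α ϑ₁ ϑ₂ x).conjTranspose.mul
    ((hasEntryDeriv_bigSigma α S₀ ϑ₁ ϑ₂ x).inv hu)).congr_deriv ?_
  rw [hL] at hadj ⊢
  simp only [Matrix.conjTranspose_smul, Matrix.conjTranspose_mul, conjTranspose_signature,
    Matrix.mul_assoc, Matrix.smul_mul]
  rw [hadj]
  simp only [Matrix.mul_assoc, Matrix.mul_sub, Matrix.mul_smul, Matrix.mul_neg, smul_sub,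
    smul_smul]
  have hB' : ∀ {k : Type} (M : Matrix (Fin n) k ℂ),
      Lᴴ * ((bigSigma α S₀ ϑ₁ ϑ₂ x)⁻¹ * M) = B * M := fun M => by rw [← Matrix.mul_assoc, hB]
  simp only [hB, hB', Complex.star_def, map_neg, Complex.conj_I, neg_neg, Complex.I_mul_I]
  module

theorem mul_resolvent {z : ℂ} (hz : IsUnit (z • 1 - α)) : α * (z • 1 - α)⁻¹ =
    z • (z • 1 - α)⁻¹ - 1 := by
  have := Matrix.mul_nonsing_inv _ ((Matrix.isUnit_iff_isUnit_det _).1 hz)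
  rw [sub_mul, Matrix.smul_mul, Matrix.one_mul] at this
  exact eq_sub_of_add_eq (eq_add_of_sub_eq' this).symm

theorem resolvent_mul {z : ℂ} (hz : IsUnit (z • 1 - α)) : (z • 1 - α)⁻¹ * α =
    z • (z • 1 - α)⁻¹ - 1 := by
  have := Matrix.nonsing_inv_mul _ ((Matrix.isUnit_iff_isUnit_det _).1 hz)
  rw [mul_sub, Matrix.mul_smul, Matrix.mul_one] at this
  exact eq_sub_of_add_eq (eq_add_of_sub_eq' this).symm

/-- The term `i j V` of the Dirac system is `G - j G j`, where `G = Λ* Σ⁻¹ Λ`. -/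
theorem smul_signature_mul_potentialMatrix (hS : S₀.PosDef) {x : ℝ} :
    Complex.I • (signature m₁ m₂ * potentialMatrix (pseudoExpPotential α S₀ ϑ₁ ϑ₂ x)) =
      (bigLambda α ϑ₁ ϑ₂ x)ᴴ * (bigSigma α S₀ ϑ₁ ϑ₂ x)⁻¹ * bigLambda α ϑ₁ ϑ₂ x -
      signature m₁ m₂ * ((bigLambda α ϑ₁ ϑ₂ x)ᴴ * (bigSigma α S₀ ϑ₁ ϑ₂ x)⁻¹ *
        bigLambda α ϑ₁ ϑ₂ x) * signature m₁ m₂ := by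
  have hinv : ((bigSigma α S₀ ϑ₁ ϑ₂ x)⁻¹)ᴴ = (bigSigma α S₀ ϑ₁ ϑ₂ x)⁻¹ :=
    (isHermitian_bigSigma hS.isHermitian x).inv.eq
  have e₁ : (NormedSpace.exp ((-(Complex.I * (x : ℂ))) • α))ᴴ =
      NormedSpace.exp ((Complex.I * (x : ℂ)) • αᴴ) := by
    rw [← Matrix.exp_conjTranspose, Matrix.conjTranspose_smul]; simp
  -- Passing from `G` to `G - jGj` kills the diagonal blocks and doubles the off-diagonal ones,
  -- which accounts for the factor `-2i` in the potential.
  have key : ∀ (P₁ : Matrix (Fin n) (Fin m₁) ℂ) (P₂ : Matrix (Fin n) (Fin m₂) ℂ)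
      (D : Matrix (Fin n) (Fin n) ℂ), Dᴴ = D →
      Complex.I • (signature m₁ m₂ * potentialMatrix ((-2 * Complex.I) • (P₁ᴴ * D * P₂))) =
        (Matrix.fromCols P₁ P₂)ᴴ * D * Matrix.fromCols P₁ P₂ -
          signature m₁ m₂ * ((Matrix.fromCols P₁ P₂)ᴴ * D * Matrix.fromCols P₁ P₂) *
            signature m₁ m₂ := by
    intro P₁ P₂ D hD
    have hI : Complex.I * (2 * Complex.I) = -2 := by linear_combination 2 * Complex.I_sq
    rw [Matrix.conjTranspose_fromCols_eq_fromRows_conjTranspose, Matrix.fromRows_mul,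
      Matrix.fromRows_mul_fromCols, signature, potentialMatrix]
    simp only [Matrix.fromBlocks_multiply, Matrix.fromBlocks_smul, sub_eq_add_neg,
      Matrix.fromBlocks_neg, Matrix.fromBlocks_add, Matrix.conjTranspose_smul,
      Matrix.conjTranspose_mul, hD, Matrix.conjTranspose_conjTranspose]
    congr 1
    · simp
    · simp [smul_smul, hI, two_smul]
    · simp [smul_smul, hI, two_smul, Matrix.mul_assoc]
    · simp
  rw [bigLambda, pseudoExpPotential, ← key _ _ _ hinv, Matrix.conjTranspose_mul, e₁]
  simp only [Matrix.mul_assoc]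

/-- Once `α(z-α)⁻¹` and `(z-α)⁻¹α` are replaced by `z(z-α)⁻¹ - 1`, the leftover terms without a
resolvent are exactly those of `G - jGj`, that is, of `i j V`. -/
theorem hasEntryDeriv_transfer (hS : S₀.PosDef)
    (hid : α * S₀ - S₀ * αᴴ = Complex.I • (ϑ₁ * ϑ₁ᴴ - ϑ₂ * ϑ₂ᴴ)) {x : ℝ} (hx : 0 ≤ x) {z : ℂ}
    (hz : IsUnit (z • 1 - α)) :
    HasEntryDeriv (fun x => transfer α S₀ ϑ₁ ϑ₂ x z)
      (coefficient (pseudoExpPotential α S₀ ϑ₁ ϑ₂) x z * transfer α S₀ ϑ₁ ϑ₂ x z -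
        (Complex.I * z) • (transfer α S₀ ϑ₁ ϑ₂ x z * signature m₁ m₂)) x := by
  obtain ⟨L, hL⟩ : ∃ L, bigLambda α ϑ₁ ϑ₂ x = L := ⟨_, rfl⟩
  obtain ⟨B, hB⟩ : ∃ B, Lᴴ * (bigSigma α S₀ ϑ₁ ϑ₂ x)⁻¹ = B := ⟨_, rfl⟩
  have hB' := hasEntryDeriv_conjTranspose_bigLambda_mul_inv hS hid hx hL hB
  have hR := mul_resolvent hz
  have hR' := resolvent_mul hz
  refine ((hasEntryDeriv_const 1 x).add (((hB'.const_mul (signature m₁ m₂)).mul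
    ((hasEntryDeriv_bigLambda α ϑ₁ ϑ₂ x).const_mul _)).const_smul Complex.I)).congr_deriv ?_
  rw [coefficient, smul_add Complex.I (z • signature m₁ m₂), smul_signature_mul_potentialMatrix hS]
  simp only [transfer, hL, hB]
  set R := (z • 1 - α)⁻¹
  set J := signature m₁ m₂
  -- The trailing factor `M` lets these rules fire inside products associated to the right.
  have hJ' : ∀ {k : Type} (M : Matrix (Fin m₁ ⊕ Fin m₂) k ℂ), J * (J * M) = M := fun M => by
    rw [← Matrix.mul_assoc, signature_mul_signature, Matrix.one_mul]
  have hαR : ∀ {k : Type} (M : Matrix (Fin n) k ℂ), α * (R * M) = z • (R * M) - M := fun M => by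
    rw [← Matrix.mul_assoc, hR, Matrix.sub_mul, Matrix.smul_mul, Matrix.one_mul]
  have hRα : ∀ {k : Type} (M : Matrix (Fin n) k ℂ), R * (α * M) = z • (R * M) - M := fun M => by
    rw [← Matrix.mul_assoc, hR', Matrix.sub_mul, Matrix.smul_mul, Matrix.one_mul]
  simp only [Matrix.mul_add, Matrix.add_mul, Matrix.mul_sub, Matrix.sub_mul, Matrix.smul_mul,
    Matrix.mul_smul, Matrix.mul_one, Matrix.one_mul, Matrix.mul_assoc, hJ', hαR, hRα, zero_add,
    smul_add, smul_sub, smul_smul, neg_mul, mul_neg, Complex.I_mul_I]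
  match_scalars <;> ring_nf

end Transfer

/-! ### Invertibility and `j`-expansivity of the Darboux matrix. -/

section TransferProperties

variable {n m₁ m₂ : ℕ} {α S₀ : Matrix (Fin n) (Fin n) ℂ} {ϑ₁ : Matrix (Fin n) (Fin m₁) ℂ}
  {ϑ₂ : Matrix (Fin n) (Fin m₂) ℂ}

theorem bigLambda_signature_eq
    (hid : α * S₀ - S₀ * αᴴ = Complex.I • (ϑ₁ * ϑ₁ᴴ - ϑ₂ * ϑ₂ᴴ)) (x : ℝ) :
    bigLambda α ϑ₁ ϑ₂ x * signature m₁ m₂ * (bigLambda α ϑ₁ ϑ₂ x)ᴴ =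
      (-Complex.I) • (α * bigSigma α S₀ ϑ₁ ϑ₂ x - bigSigma α S₀ ϑ₁ ϑ₂ x * αᴴ) := by
  rw [bigSigma_identity hid, smul_smul]; simp

theorem isUnit_transfer (hS : S₀.PosDef)
    (hid : α * S₀ - S₀ * αᴴ = Complex.I • (ϑ₁ * ϑ₁ᴴ - ϑ₂ * ϑ₂ᴴ)) {x : ℝ} (hx : 0 ≤ x) {z : ℂ}
    (hz : IsUnit (z • 1 - α)) (hz' : IsUnit (z • 1 - αᴴ)) :
    IsUnit (transfer α S₀ ϑ₁ ϑ₂ x z) := by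
  have hY := bigLambda_signature_eq hid x
  have hdet : IsUnit (bigSigma α S₀ ϑ₁ ϑ₂ x).det :=
    (Matrix.isUnit_iff_isUnit_det _).1 (posDef_bigSigma hS hx).isUnit
  simp only [transfer]
  set L := bigLambda α ϑ₁ ϑ₂ x
  set S := bigSigma α S₀ ϑ₁ ϑ₂ x
  have h₁ : (z • 1 - α)⁻¹ * (z • 1 - α) = 1 :=
    Matrix.nonsing_inv_mul _ ((Matrix.isUnit_iff_isUnit_det _).1 hz)
  have h₂ : (z • 1 - αᴴ) * (z • 1 - αᴴ)⁻¹ = 1 :=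
    Matrix.mul_nonsing_inv _ ((Matrix.isUnit_iff_isUnit_det _).1 hz')
  set R := (z • 1 - α)⁻¹
  set K := (z • 1 - αᴴ)⁻¹
  set J := signature m₁ m₂
  -- With `αΣ - Σα* = Σ(z-α*) - (z-α)Σ`, each resolvent cancels one factor. The quadratic term of
  -- the product below thereby becomes minus its linear terms.
  have hmid : S⁻¹ * R * (L * J * Lᴴ) * (K * S⁻¹) = (-Complex.I) • (S⁻¹ * R - K * S⁻¹) := by
    have e : α * S - S * αᴴ = S * (z • 1 - αᴴ) - (z • 1 - α) * S := by
      simp only [mul_sub, sub_mul, Matrix.mul_smul, Matrix.smul_mul, mul_one, one_mul]; abel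
    rw [hY, e, Matrix.mul_smul, Matrix.smul_mul]
    congr 1
    calc S⁻¹ * R * (S * (z • 1 - αᴴ) - (z • 1 - α) * S) * (K * S⁻¹)
        = S⁻¹ * R * S * ((z • 1 - αᴴ) * K) * S⁻¹ - S⁻¹ * (R * (z • 1 - α)) * S * K * S⁻¹ := by
          noncomm_ring
      _ = S⁻¹ * R - K * S⁻¹ := by
          rw [h₁, h₂, mul_one, mul_one, Matrix.nonsing_inv_mul _ hdet, one_mul,
            Matrix.mul_nonsing_inv_cancel_right _ _ hdet]
  refine IsUnit.of_mul_eq_one (1 - Complex.I • (J * Lᴴ * (K * S⁻¹ * L))) ?_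
  calc (1 + Complex.I • (J * (Lᴴ * S⁻¹) * (R * L))) * (1 - Complex.I • (J * Lᴴ * (K * S⁻¹ * L)))
      = 1 + Complex.I • (J * Lᴴ * (S⁻¹ * R - K * S⁻¹) * L) +
          J * Lᴴ * (S⁻¹ * R * (L * J * Lᴴ) * (K * S⁻¹)) * L := by
        simp only [add_mul, mul_sub, Matrix.mul_sub, Matrix.sub_mul,
          Matrix.mul_smul, Matrix.smul_mul, one_mul, mul_one, smul_smul, Complex.I_mul_I,
          Matrix.mul_assoc]
        module
    _ = 1 := by
        rw [hmid]
        simp only [Matrix.mul_smul, Matrix.smul_mul]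
        module

/-- For `Im z ≥ 0` the added term is nonnegative, so `W* j W ≥ j`; this is the source of
property-`j` for the column of `W`. -/
theorem conjTranspose_transfer_mul (hS : S₀.PosDef)
    (hid : α * S₀ - S₀ * αᴴ = Complex.I • (ϑ₁ * ϑ₁ᴴ - ϑ₂ * ϑ₂ᴴ)) {x : ℝ} (hx : 0 ≤ x) {z : ℂ}
    (hz : IsUnit (z • 1 - α)) :
    (transfer α S₀ ϑ₁ ϑ₂ x z)ᴴ * signature m₁ m₂ * transfer α S₀ ϑ₁ ϑ₂ x z =
      signature m₁ m₂ + (2 * z.im : ℂ) • (((z • 1 - α)⁻¹ * bigLambda α ϑ₁ ϑ₂ x)ᴴ *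
        (bigSigma α S₀ ϑ₁ ϑ₂ x)⁻¹ * ((z • 1 - α)⁻¹ * bigLambda α ϑ₁ ϑ₂ x)) := by
  have hY := bigLambda_signature_eq hid x
  have hdet : IsUnit (bigSigma α S₀ ϑ₁ ϑ₂ x).det :=
    (Matrix.isUnit_iff_isUnit_det _).1 (posDef_bigSigma hS hx).isUnit
  have hSi : ((bigSigma α S₀ ϑ₁ ϑ₂ x)⁻¹)ᴴ = (bigSigma α S₀ ϑ₁ ϑ₂ x)⁻¹ :=
    (isHermitian_bigSigma hS.isHermitian x).inv.eq
  simp only [transfer]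
  set L := bigLambda α ϑ₁ ϑ₂ x
  set S := bigSigma α S₀ ϑ₁ ϑ₂ x
  set T := z • 1 - α with hT
  have hTR : T * T⁻¹ = 1 := Matrix.mul_nonsing_inv _ ((Matrix.isUnit_iff_isUnit_det _).1 hz)
  have hRT : T⁻¹ᴴ * Tᴴ = 1 := by rw [← Matrix.conjTranspose_mul, hTR, Matrix.conjTranspose_one]
  set R := T⁻¹
  have hJJ : signature m₁ m₂ * signature m₁ m₂ = 1 := signature_mul_signature
  have hJc : (signature m₁ m₂)ᴴ = signature m₁ m₂ := conjTranspose_signature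
  set J := signature m₁ m₂
  have hJ' : ∀ {k : Type} (M : Matrix (Fin m₁ ⊕ Fin m₂) k ℂ), J * (J * M) = M := fun M => by
    rw [← Matrix.mul_assoc, hJJ, Matrix.one_mul]
  have hmid : Rᴴ * S⁻¹ * (L * J * Lᴴ) * (S⁻¹ * R) =
      (2 * z.im : ℂ) • (Rᴴ * S⁻¹ * R) + Complex.I • (Rᴴ * S⁻¹) - Complex.I • (S⁻¹ * R) := by
    have e : α * S - S * αᴴ = (2 * z.im * Complex.I : ℂ) • S - T * S + S * Tᴴ := by
      have hzz : (2 * z.im * Complex.I : ℂ) = z - (starRingEnd ℂ) z := by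
        apply Complex.ext <;> simp; ring
      rw [hzz, hT]
      simp only [Matrix.conjTranspose_sub, Matrix.conjTranspose_smul, Matrix.conjTranspose_one,
        mul_sub, sub_mul, Matrix.mul_smul, Matrix.smul_mul, mul_one, one_mul, sub_smul,
        Complex.star_def]
      abel
    have e' : Rᴴ * S⁻¹ * ((2 * z.im * Complex.I : ℂ) • S - T * S + S * Tᴴ) * (S⁻¹ * R) =
        (2 * z.im * Complex.I : ℂ) • (Rᴴ * S⁻¹ * R) - Rᴴ * S⁻¹ + S⁻¹ * R := by
      simp only [mul_add, add_mul, mul_sub, sub_mul, Matrix.mul_smul, Matrix.smul_mul, mul_assoc]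
      rw [Matrix.mul_nonsing_inv_cancel_left _ _ hdet, hTR, mul_one,
        Matrix.nonsing_inv_mul_cancel_left _ _ hdet, ← mul_assoc Rᴴ Tᴴ, hRT, one_mul]
    rw [hY, e, Matrix.mul_smul, Matrix.smul_mul, e']
    match_scalars <;> ring_nf
    simp [Complex.I_sq]
  calc (1 + Complex.I • (J * (Lᴴ * S⁻¹) * (R * L)))ᴴ * J *
        (1 + Complex.I • (J * (Lᴴ * S⁻¹) * (R * L)))
      = J + Complex.I • (Lᴴ * (S⁻¹ * R) * L) - Complex.I • (Lᴴ * (Rᴴ * S⁻¹) * L) +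
          Lᴴ * (Rᴴ * S⁻¹ * (L * J * Lᴴ) * (S⁻¹ * R)) * L := by
        simp only [Matrix.conjTranspose_add, Matrix.conjTranspose_one, Matrix.conjTranspose_smul,
          Matrix.conjTranspose_mul, hSi, hJc, Matrix.conjTranspose_conjTranspose,
          Complex.star_def, Complex.conj_I, mul_add, add_mul,
          Matrix.mul_smul, Matrix.smul_mul, one_mul, mul_one, smul_smul, Matrix.mul_assoc, hJ',
          hJJ, Matrix.mul_one]
        match_scalars <;> ring_nf
        simp
    _ = _ := by
        rw [hmid]
        simp only [Matrix.mul_add, Matrix.add_mul, Matrix.mul_sub, Matrix.sub_mul,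
          Matrix.mul_smul, Matrix.smul_mul, Matrix.conjTranspose_mul, Matrix.mul_assoc]
        module

end TransferProperties

/-! ### The free solution, and completion of a partially known fundamental solution. -/

section FundamentalSolution

variable {m₁ m₂ : ℕ}

/-- The matrix `e^{i x z j}`. -/
noncomputable def freeSolution (m₁ m₂ : ℕ) (x : ℝ) (z : ℂ) :
    Matrix (Fin m₁ ⊕ Fin m₂) (Fin m₁ ⊕ Fin m₂) ℂ :=
  Matrix.fromBlocks (Complex.exp (Complex.I * z * x) • 1) 0 0
    (Complex.exp (-(Complex.I * z * x)) • 1)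

theorem hasEntryDeriv_freeSolution (x : ℝ) (z : ℂ) :
    HasEntryDeriv (fun x => freeSolution m₁ m₂ x z)
      ((Complex.I * z) • (signature m₁ m₂ * freeSolution m₁ m₂ x z)) x := by
  have h : ∀ c : ℂ, HasDerivAt (fun s : ℝ => Complex.exp (c * s)) (Complex.exp (c * x) * c) x :=
    fun c => by
      have : HasDerivAt (fun s : ℝ => c * (s : ℂ)) c x := by
        simpa using (Complex.ofRealCLM.hasDerivAt (x := x)).const_mul c
      exact this.cexp
  rintro (i | i) (k | k)
  · simpa [freeSolution, signature, Matrix.fromBlocks_multiply, mul_comm, mul_left_comm,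
      mul_assoc] using
      (h (Complex.I * z)).mul_const ((1 : Matrix (Fin m₁) (Fin m₁) ℂ) i k)
  · simpa [freeSolution, signature, Matrix.fromBlocks_multiply] using hasDerivAt_const x (0 : ℂ)
  · simpa [freeSolution, signature, Matrix.fromBlocks_multiply] using hasDerivAt_const x (0 : ℂ)
  · simpa [freeSolution, signature, Matrix.fromBlocks_multiply, mul_comm, mul_left_comm,
      mul_assoc] using
      (h (-(Complex.I * z))).mul_const ((1 : Matrix (Fin m₂) (Fin m₂) ℂ) i k)

@[simp] theorem freeSolution_zero (z : ℂ) : freeSolution m₁ m₂ 0 z = 1 := by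
  simp [freeSolution]

theorem freeSolution_mul_neg (x : ℝ) (z : ℂ) :
    freeSolution m₁ m₂ x z * freeSolution m₁ m₂ (-x) z = 1 := by
  simp [freeSolution, Matrix.fromBlocks_multiply, smul_smul, ← Complex.exp_add]

variable {v : ℝ → Matrix (Fin m₁) (Fin m₂) ℂ}

theorem continuousOn_coefficient (hv : ∀ i k, ContinuousOn (fun x => v x i k) (Set.Ici 0)) (z : ℂ)
    (i k : Fin m₁ ⊕ Fin m₂) : ContinuousOn (fun x => coefficient v x z i k) (Set.Ici 0) := by
  rcases i with i | i <;> rcases k with k | k <;>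
    simp only [coefficient, signature, potentialMatrix, Matrix.fromBlocks_multiply,
      Matrix.smul_apply, Matrix.add_apply, Matrix.fromBlocks_apply₁₁, Matrix.fromBlocks_apply₁₂,
      Matrix.fromBlocks_apply₂₁, Matrix.fromBlocks_apply₂₂]
  · simpa using continuousOn_const
  · simpa using continuousOn_const.fun_mul (hv i k)
  · simpa using (continuousOn_const (c := Complex.I).fun_mul (hv k i).star).fun_neg
  · simpa using continuousOn_const

theorem continuousOn_coefficient_mul (hv : ∀ i k, ContinuousOn (fun x => v x i k) (Set.Ici 0))
    {z : ℂ} {U : ℝ → Matrix (Fin m₁ ⊕ Fin m₂) (Fin m₁ ⊕ Fin m₂) ℂ}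
    (hU : ∀ i k, ContinuousOn (fun x => U x i k) (Set.Ici 0)) (i k : Fin m₁ ⊕ Fin m₂) :
    ContinuousOn (fun x => (coefficient v x z * U x) i k) (Set.Ici 0) := by
  simp only [Matrix.mul_apply]
  exact continuousOn_finsetSum _ fun l _ => (continuousOn_coefficient hv z i l).mul (hU l k)

theorem intervalIntegrable_of_continuousOn_Ici {f : ℝ → ℂ} (hf : ContinuousOn f (Set.Ici 0))
    {x : ℝ} (hx : 0 ≤ x) : IntervalIntegrable f MeasureTheory.volume 0 x :=
  (hf.mono (by rw [Set.uIcc_of_le hx]; exact Set.Icc_subset_Ici_self)).intervalIntegrable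

/-- For a potential continuous on `[0, ∞)`, a function that solves the initial value problem
classically for `z ∉ e` extends to a fundamental solution. -/
theorem exists_isFundamentalSolution
    (hv : ∀ i k, ContinuousOn (fun x => v x i k) (Set.Ici 0)) (e : Set ℂ)
    (u₀ : ℝ → ℂ → Matrix (Fin m₁ ⊕ Fin m₂) (Fin m₁ ⊕ Fin m₂) ℂ) (h0 : ∀ z ∉ e, u₀ 0 z = 1)
    (hu₀ : ∀ z ∉ e, ∀ x, 0 ≤ x →
      HasEntryDeriv (fun x => u₀ x z) (coefficient v x z * u₀ x z) x) :
    ∃ u, IsFundamentalSolution v u ∧ ∀ z ∉ e, ∀ x, u x z = u₀ x z := by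
  have hex : ∀ z : ℂ, ∃ U : ℝ → Matrix (Fin m₁ ⊕ Fin m₂) (Fin m₁ ⊕ Fin m₂) ℂ,
      (∀ i k, ContinuousOn (fun t => U t i k) (Set.Ici 0)) ∧
      (∀ t, 0 ≤ t → ∀ i k, U t i k =
        (1 : Matrix (Fin m₁ ⊕ Fin m₂) (Fin m₁ ⊕ Fin m₂) ℂ) i k +
        ∫ s in (0 : ℝ)..t, (coefficient v s z * U s) i k) ∧ (z ∉ e → ∀ x, U x = u₀ x z) := by
    intro z
    by_cases hz : z ∈ e
    · obtain ⟨U, hUc, hU⟩ := exists_matrix_integral_solution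
        -- Freezing the coefficient on the negative axis makes it continuous on the whole line
        -- without changing it on `[0, ∞)`.
        (A := fun t => coefficient v (max t 0) z) fun i k =>
          (continuousOn_coefficient hv z i k).comp_continuous
            (continuous_id.max continuous_const) fun t => Set.mem_Ici.2 (le_max_right _ _)
      refine ⟨U, hUc, fun t ht i k => ?_, fun h => absurd hz h⟩
      rw [hU t ht i k]
      congr 1
      refine intervalIntegral.integral_congr fun s hs => ?_
      rw [Set.uIcc_of_le ht] at hs
      simp only [max_eq_left hs.1]
    · have hc : ∀ i k, ContinuousOn (fun t => u₀ t z i k) (Set.Ici 0) := fun i k t ht =>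
        (hu₀ z hz t ht i k).continuousAt.continuousWithinAt
      refine ⟨fun x => u₀ x z, hc, fun t ht i k => ?_, fun _ _ => rfl⟩
      rw [intervalIntegral.integral_eq_sub_of_hasDerivAt
        (fun s hs => hu₀ z hz s (by rw [Set.uIcc_of_le ht] at hs; exact hs.1) i k)
        (intervalIntegrable_of_continuousOn_Ici (continuousOn_coefficient_mul hv hc i k) ht)]
      simp [h0 z hz]
  choose U hUc hU hUe using hex
  refine ⟨fun x z => U z x, ⟨fun z x hx i k => ?_, fun z x hx i k => hU z x hx i k⟩,
    fun z hz x => hUe z hz x⟩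
  exact intervalIntegrable_of_continuousOn_Ici (continuousOn_coefficient_mul hv (hUc z) i k) hx

end FundamentalSolution

/-! ### The Euclidean norm and the indefinite form. -/

section Forms

variable {p : Type*} [Fintype p] {m₁ m₂ : ℕ}

/-- The squared Euclidean norm of a vector. -/
def sqNorm (y : p → ℂ) : ℝ := ∑ i, Complex.normSq (y i)

/-- The indefinite form `y* j y`. -/
def signatureForm (y : Fin m₁ ⊕ Fin m₂ → ℂ) : ℝ :=
  sqNorm (fun i => y (Sum.inl i)) - sqNorm (fun k => y (Sum.inr k))

theorem sqNorm_nonneg (y : p → ℂ) : 0 ≤ sqNorm y :=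
  Finset.sum_nonneg fun _ _ => Complex.normSq_nonneg _

theorem sqNorm_eq_zero {y : p → ℂ} : sqNorm y = 0 ↔ y = 0 := by
  rw [sqNorm, Finset.sum_eq_zero_iff_of_nonneg fun _ _ => Complex.normSq_nonneg _]
  simp [funext_iff]

theorem sqNorm_sum (y : Fin m₁ ⊕ Fin m₂ → ℂ) :
    sqNorm y = sqNorm (fun i => y (Sum.inl i)) + sqNorm (fun k => y (Sum.inr k)) := by
  simp [sqNorm, Fintype.sum_sum_type]

theorem sqNorm_sub_le (y w : p → ℂ) : sqNorm (y - w) ≤ 2 * sqNorm y + 2 * sqNorm w := by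
  simp only [sqNorm, Finset.mul_sum, ← Finset.sum_add_distrib]
  refine Finset.sum_le_sum fun i _ => ?_
  simp only [Pi.sub_apply, Complex.normSq_apply, Complex.sub_re, Complex.sub_im]
  nlinarith [sq_nonneg ((y i).re + (w i).re), sq_nonneg ((y i).im + (w i).im)]

theorem continuous_sqNorm : Continuous (sqNorm : (p → ℂ) → ℝ) :=
  continuous_finsetSum _ fun i _ => Complex.continuous_normSq.comp (continuous_apply i)

theorem star_dotProduct_self (y : p → ℂ) : star y ⬝ᵥ y = (sqNorm y : ℂ) := by
  simp [sqNorm, dotProduct, Complex.normSq_eq_conj_mul_self]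

theorem star_dotProduct_signature (y : Fin m₁ ⊕ Fin m₂ → ℂ) :
    star y ⬝ᵥ signature m₁ m₂ *ᵥ y = (signatureForm y : ℂ) := by
  have h : signature m₁ m₂ *ᵥ y =
      Sum.elim (fun i => y (Sum.inl i)) (-fun k => y (Sum.inr k)) := by
    rw [signature, Matrix.fromBlocks_mulVec]
    simp [Function.comp_def, Matrix.neg_mulVec]
  rw [h]
  simp [dotProduct, signatureForm, sqNorm, Complex.normSq_eq_conj_mul_self, sub_eq_add_neg]

theorem star_dotProduct_conjTranspose_mul_mul {r : Type*} [Fintype r]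
    (A : Matrix r p ℂ) (H : Matrix r r ℂ) (y : p → ℂ) :
    star y ⬝ᵥ (Aᴴ * H * A) *ᵥ y = star (A *ᵥ y) ⬝ᵥ H *ᵥ (A *ᵥ y) := by
  rw [Matrix.star_mulVec, ← Matrix.dotProduct_mulVec, Matrix.mulVec_mulVec, Matrix.mulVec_mulVec]

theorem HasEntryDeriv.re_star_dotProduct {H : ℝ → Matrix p p ℂ} {H' : Matrix p p ℂ} {t : ℝ}
    (hH : HasEntryDeriv H H' t) (c : p → ℂ) :
    HasDerivAt (fun s => (star c ⬝ᵥ H s *ᵥ c).re) (star c ⬝ᵥ H' *ᵥ c).re t := by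
  refine Complex.reCLM.hasFDerivAt.comp_hasDerivAt t ?_
  simp only [dotProduct, Matrix.mulVec]
  exact HasDerivAt.fun_sum fun i _ => (HasDerivAt.fun_sum fun k _ =>
    (hH i k).mul_const (c k)).const_mul _

end Forms

/-! ### Energy identity and shrinking of the Weyl discs. -/

section WeylDisc

variable {m₁ m₂ : ℕ} {v : ℝ → Matrix (Fin m₁) (Fin m₂) ℂ} {z : ℂ}
  {U : ℝ → Matrix (Fin m₁ ⊕ Fin m₂) (Fin m₁ ⊕ Fin m₂) ℂ}

/-- The energy identity `(y* j y)' = -2 Im z · y* y` for the solutions of the Dirac system. -/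
theorem hasDerivAt_signatureForm {t : ℝ} (hU : HasEntryDeriv U (coefficient v t z * U t) t)
    (c : Fin m₁ ⊕ Fin m₂ → ℂ) :
    HasDerivAt (fun t => signatureForm (U t *ᵥ c)) (-2 * z.im * sqNorm (U t *ᵥ c)) t := by
  have h := ((hU.conjTranspose.mul_const (signature m₁ m₂)).mul hU).re_star_dotProduct c
  simp only [star_dotProduct_conjTranspose_mul_mul, star_dotProduct_signature,
    Complex.ofReal_re] at h
  convert h using 1
  have e : (coefficient v t z * U t)ᴴ * signature m₁ m₂ * U t +
      (U t)ᴴ * signature m₁ m₂ * (coefficient v t z * U t) =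
      (-2 * z.im : ℂ) • ((U t)ᴴ * 1 * U t) := by
    rw [← Matrix.smul_mul, ← Matrix.mul_smul, ← conjTranspose_coefficient_mul_signature v t z,
      Matrix.conjTranspose_mul]
    simp only [Matrix.mul_add, Matrix.add_mul, Matrix.mul_assoc]
  rw [e, Matrix.smul_mulVec, dotProduct_smul, star_dotProduct_conjTranspose_mul_mul,
    Matrix.one_mulVec, star_dotProduct_self]
  simp

theorem antitoneOn_signatureForm (hU : ∀ t, 0 ≤ t → HasEntryDeriv U (coefficient v t z * U t) t)
    (hz : 0 ≤ z.im) (c : Fin m₁ ⊕ Fin m₂ → ℂ) :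
    AntitoneOn (fun t => signatureForm (U t *ᵥ c)) (Set.Ici 0) := by
  refine antitoneOn_of_deriv_nonpos (convex_Ici 0)
    (fun t ht => (hasDerivAt_signatureForm (hU t ht) c).continuousAt.continuousWithinAt)
    (fun t ht => (hasDerivAt_signatureForm (hU t (interior_subset ht))
      c).differentiableAt.differentiableWithinAt) fun t ht => ?_
  rw [(hasDerivAt_signatureForm (hU t (interior_subset ht)) c).deriv]
  nlinarith [mul_nonneg hz (sqNorm_nonneg (U t *ᵥ c))]

/-- Two points of the Weyl disc at `x` are at distance `O(x ^ (-1/2))`. -/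
theorem mul_sqNorm_sub_le (hU : ∀ t, 0 ≤ t → HasEntryDeriv U (coefficient v t z * U t) t)
    (hU0 : U 0 = 1) (hz : 0 ≤ z.im) {x : ℝ} (hx : 0 ≤ x) {ξ : Fin m₁ → ℂ} {b₁ b₂ : Fin m₂ → ℂ}
    (h₁ : 0 ≤ signatureForm (U x *ᵥ Sum.elim ξ b₁))
    (h₂ : 0 ≤ signatureForm (U x *ᵥ Sum.elim ξ b₂)) :
    x * z.im * sqNorm (b₁ - b₂) ≤ 2 * sqNorm ξ := by
  have hdiff : ∀ t, U t *ᵥ Sum.elim ξ b₁ - U t *ᵥ Sum.elim ξ b₂ =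
      U t *ᵥ Sum.elim (0 : Fin m₁ → ℂ) (b₁ - b₂) := by
    intro t
    rw [← Matrix.mulVec_sub]
    congr 1
    ext (i | i) <;> simp
  -- The difference of the two solutions starts at `[0; b₁ - b₂]`, where the form is `-|b₁ - b₂|²`.
  -- The form does not increase, so the norm of the difference never falls below this value.
  have hlow : ∀ t, 0 ≤ t → sqNorm (b₁ - b₂) ≤
      2 * sqNorm (U t *ᵥ Sum.elim ξ b₁) + 2 * sqNorm (U t *ᵥ Sum.elim ξ b₂) := by
    intro t ht
    refine le_trans ?_ (sqNorm_sub_le _ _)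
    rw [hdiff]
    have h := antitoneOn_signatureForm hU hz (Sum.elim (0 : Fin m₁ → ℂ) (b₁ - b₂))
      Set.self_mem_Ici ht ht
    have h0 : sqNorm (fun _ : Fin m₁ => (0 : ℂ)) = 0 := sqNorm_eq_zero.2 rfl
    simp only [hU0, Matrix.one_mulVec] at h
    rw [sqNorm_sum]
    simp only [signatureForm, Sum.elim_inl, Sum.elim_inr, Pi.zero_apply, h0] at h
    linarith [sqNorm_nonneg fun i => (U t *ᵥ Sum.elim (0 : Fin m₁ → ℂ) (b₁ - b₂)) (Sum.inl i)]
  have hd : ∀ t, 0 ≤ t → HasDerivAt (fun t => signatureForm (U t *ᵥ Sum.elim ξ b₁) +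
      signatureForm (U t *ᵥ Sum.elim ξ b₂) + z.im * sqNorm (b₁ - b₂) * t)
      (-2 * z.im * sqNorm (U t *ᵥ Sum.elim ξ b₁) + -2 * z.im * sqNorm (U t *ᵥ Sum.elim ξ b₂) +
        z.im * sqNorm (b₁ - b₂)) t := fun t ht => by
    simpa using ((hasDerivAt_signatureForm (hU t ht) _).fun_add
      (hasDerivAt_signatureForm (hU t ht) _)).fun_add ((hasDerivAt_id t).const_mul _)
  -- The lower bound makes the energy loss pay for the linear term. Comparing the endpoints, the
  -- value at `0` is at most `2|ξ|²` and the value at `x` is at least `x · Im z · |b₁ - b₂|²`.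
  have hanti : AntitoneOn (fun t => signatureForm (U t *ᵥ Sum.elim ξ b₁) +
      signatureForm (U t *ᵥ Sum.elim ξ b₂) + z.im * sqNorm (b₁ - b₂) * t) (Set.Ici 0) := by
    refine antitoneOn_of_deriv_nonpos (convex_Ici 0)
      (fun t ht => (hd t ht).continuousAt.continuousWithinAt)
      (fun t ht => (hd t (interior_subset ht)).differentiableAt.differentiableWithinAt)
      fun t ht => ?_
    rw [(hd t (interior_subset ht)).deriv]
    nlinarith [mul_le_mul_of_nonneg_left (hlow t (interior_subset ht)) hz]
  have h := hanti Set.self_mem_Ici hx hx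
  simp only [hU0, Matrix.one_mulVec, signatureForm, Sum.elim_inl, Sum.elim_inr] at h h₁ h₂
  linarith [sqNorm_nonneg b₁, sqNorm_nonneg b₂]

/-- The values of the linear fractional expression lie in the Weyl disc. -/
theorem signatureForm_moebius_nonneg {A : Matrix (Fin m₁ ⊕ Fin m₂) (Fin m₁ ⊕ Fin m₂) ℂ}
    (hA : IsUnit A) (hcontr : ∀ y, signatureForm (A *ᵥ y) ≤ signatureForm y)
    {Q : Matrix (Fin m₁ ⊕ Fin m₂) (Fin m₁) ℂ} (hQ : (Qᴴ * Q).PosDef)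
    (hQj : (Qᴴ * signature m₁ m₂ * Q).PosSemidef) (ξ : Fin m₁ → ℂ) :
    0 ≤ signatureForm (A *ᵥ Sum.elim ξ (moebius A Q *ᵥ ξ)) := by
  have hdet : IsUnit A.det := (Matrix.isUnit_iff_isUnit_det _).1 hA
  have hform : ∀ w, 0 ≤ signatureForm (Q *ᵥ w) := fun w => by
    have := hQj.dotProduct_mulVec_nonneg w
    rw [star_dotProduct_conjTranspose_mul_mul, star_dotProduct_signature] at this
    exact_mod_cast this
  set M := A⁻¹ * Q with hM
  have hAM : ∀ w, A *ᵥ (M *ᵥ w) = Q *ᵥ w := fun w => by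
    rw [Matrix.mulVec_mulVec, hM, Matrix.mul_nonsing_inv_cancel_left _ _ hdet]
  have hMrows : M = Matrix.fromRows M.toRows₁ M.toRows₂ := (Matrix.fromRows_toRows M).symm
  have hMw : ∀ w, M *ᵥ w = Sum.elim (M.toRows₁ *ᵥ w) (M.toRows₂ *ᵥ w) := fun w => by
    conv_lhs => rw [hMrows]
    exact Matrix.fromRows_mulVec _ _ _
  have hmoeb : moebius A Q = M.toRows₂ * M.toRows₁⁻¹ := by
    have e₁ : Matrix.fromCols (1 : Matrix (Fin m₁) (Fin m₁) ℂ) (0 : Matrix (Fin m₁) (Fin m₂) ℂ) * M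
        = M.toRows₁ := by
      conv_lhs => rw [hMrows, Matrix.fromCols_mul_fromRows]
      simp
    have e₂ : Matrix.fromCols (0 : Matrix (Fin m₂) (Fin m₁) ℂ) (1 : Matrix (Fin m₂) (Fin m₂) ℂ) * M
        = M.toRows₂ := by
      conv_lhs => rw [hMrows, Matrix.fromCols_mul_fromRows]
      simp
    rw [moebius, Matrix.mul_assoc _ A⁻¹, Matrix.mul_assoc _ A⁻¹, ← hM, e₁, e₂]
  -- If the upper block of `A⁻¹Qw` vanishes, then `0 ≤ (Qw)* j (Qw)` is at most minus the squared
  -- norm of the lower block. Hence `Qw = 0`, and `Q*Q > 0` gives `w = 0`.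
  have hunit : IsUnit M.toRows₁ := by
    rw [← Matrix.mulVec_injective_iff_isUnit]
    refine (injective_iff_map_eq_zero (Matrix.mulVecLin M.toRows₁)).2 fun w hw => ?_
    have hw : M.toRows₁ *ᵥ w = 0 := hw
    have h1 := (hform w).trans ((hAM w).symm ▸ hcontr (M *ᵥ w))
    have h0 : sqNorm (fun _ : Fin m₁ => (0 : ℂ)) = 0 := sqNorm_eq_zero.2 rfl
    rw [hMw, hw] at h1
    simp only [signatureForm, Sum.elim_inl, Sum.elim_inr, Pi.zero_apply, h0] at h1
    have h2 : M.toRows₂ *ᵥ w = 0 :=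
      sqNorm_eq_zero.1 (le_antisymm (by linarith) (sqNorm_nonneg _))
    have h3 : Q *ᵥ w = 0 := by
      rw [← hAM, hMw, hw, h2]; simp
    by_contra hne
    have h4 := hQ.dotProduct_mulVec_pos hne
    rw [← Matrix.mulVec_mulVec, h3] at h4
    simp at h4
  have hdet₁ : IsUnit M.toRows₁.det := (Matrix.isUnit_iff_isUnit_det _).1 hunit
  have hkey : Sum.elim ξ (moebius A Q *ᵥ ξ) = M *ᵥ (M.toRows₁⁻¹ *ᵥ ξ) := by
    rw [hMw, hmoeb, Matrix.mulVec_mulVec, Matrix.mulVec_mulVec, Matrix.mul_nonsing_inv _ hdet₁,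
      Matrix.one_mulVec]
  rw [hkey, hAM]
  exact hform _

end WeylDisc

/-! ### Resolvents: invertibility of `z - θ`, meromorphy, continuity. -/

section Resolvent

variable {n m₁ m₂ : ℕ}

/-- A matrix with positive definite imaginary part is invertible. -/
theorem isUnit_of_posDef_imaginaryPart {N : Matrix (Fin n) (Fin n) ℂ}
    (hN : ((-Complex.I) • (N - Nᴴ)).PosDef) : IsUnit N := by
  rw [← Matrix.mulVec_injective_iff_isUnit]
  refine (injective_iff_map_eq_zero (Matrix.mulVecLin N)).2 fun w hw => ?_
  have hw : N *ᵥ w = 0 := hw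
  by_contra hne
  have h := hN.dotProduct_mulVec_pos hne
  have h2 : star w ⬝ᵥ Nᴴ *ᵥ w = 0 := by
    rw [Matrix.dotProduct_mulVec, ← Matrix.star_mulVec, hw]; simp
  rw [Matrix.smul_mulVec, dotProduct_smul, Matrix.sub_mulVec, dotProduct_sub, hw, h2] at h
  simp at h

/-- For `N = (z - θ)Σ₀` the identity gives `-i(N - N*) = 2 Im z Σ₀ + ϑ₁ϑ₁* + ϑ₂ϑ₂*`, which is
positive definite. -/
theorem isUnit_sub_theta {α S₀ : Matrix (Fin n) (Fin n) ℂ} {ϑ₁ : Matrix (Fin n) (Fin m₁) ℂ}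
    {ϑ₂ : Matrix (Fin n) (Fin m₂) ℂ} (hS : S₀.PosDef)
    (hid : α * S₀ - S₀ * αᴴ = Complex.I • (ϑ₁ * ϑ₁ᴴ - ϑ₂ * ϑ₂ᴴ)) {z : ℂ} (hz : z ∈ upperHalf) :
    IsUnit (z • (1 : Matrix (Fin n) (Fin n) ℂ) - theta α S₀ ϑ₁) := by
  have hz : 0 < z.im := hz
  have hdet : IsUnit S₀.det := (Matrix.isUnit_iff_isUnit_det _).1 hS.isUnit
  have hmul : (z • (1 : Matrix (Fin n) (Fin n) ℂ) - theta α S₀ ϑ₁) * S₀ =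
      z • S₀ - α * S₀ + Complex.I • (ϑ₁ * ϑ₁ᴴ) := by
    simp only [theta, sub_mul, Matrix.smul_mul, one_mul]
    rw [Matrix.nonsing_inv_mul_cancel_right _ _ hdet]
    abel
  have hpos : ((-Complex.I) • ((z • S₀ - α * S₀ + Complex.I • (ϑ₁ * ϑ₁ᴴ)) -
      (z • S₀ - α * S₀ + Complex.I • (ϑ₁ * ϑ₁ᴴ))ᴴ)).PosDef := by
    have e : (-Complex.I) • ((z • S₀ - α * S₀ + Complex.I • (ϑ₁ * ϑ₁ᴴ)) -
        (z • S₀ - α * S₀ + Complex.I • (ϑ₁ * ϑ₁ᴴ))ᴴ) =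
        (2 * z.im : ℂ) • S₀ + (ϑ₁ * ϑ₁ᴴ + ϑ₂ * ϑ₂ᴴ) := by
      have hzz : (2 * z.im : ℂ) = -Complex.I * (z - (starRingEnd ℂ) z) := by
        apply Complex.ext <;> simp; ring
      have hα : S₀ * αᴴ = α * S₀ - Complex.I • (ϑ₁ * ϑ₁ᴴ - ϑ₂ * ϑ₂ᴴ) := by rw [← hid]; abel
      simp only [Matrix.conjTranspose_add, Matrix.conjTranspose_sub, Matrix.conjTranspose_smul,
        Matrix.conjTranspose_mul, hS.isHermitian.eq, Matrix.conjTranspose_conjTranspose, hα,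
        Complex.star_def, Complex.conj_I, hzz]
      match_scalars <;> ring_nf <;> simp
    rw [e]
    exact (hS.smul (by simpa using hz)).add_posSemidef
      ((Matrix.posSemidef_self_mul_conjTranspose _).add
        (Matrix.posSemidef_self_mul_conjTranspose _))
  have := isUnit_of_posDef_imaginaryPart hpos
  rw [← hmul, Matrix.isUnit_iff_isUnit_det, Matrix.det_mul] at this
  exact (Matrix.isUnit_iff_isUnit_det _).2 (isUnit_of_mul_isUnit_left this)

theorem finite_not_isUnit_sub (A : Matrix (Fin n) (Fin n) ℂ) :
    {z : ℂ | ¬ IsUnit (z • 1 - A)}.Finite := by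
  refine (A.charpoly.roots.toFinset.finite_toSet).subset fun z hz => ?_
  simp only [Finset.mem_coe, Multiset.mem_toFinset, Polynomial.mem_roots A.charpoly_monic.ne_zero,
    Polynomial.IsRoot, Matrix.eval_charpoly]
  have hz : ¬ IsUnit (z • 1 - A) := hz
  rw [Matrix.isUnit_iff_isUnit_det, isUnit_iff_ne_zero, not_not] at hz
  rw [← hz, Matrix.smul_one_eq_diagonal]
  rfl

theorem analyticAt_det {p : Type*} [Fintype p] [DecidableEq p] {A : ℂ → Matrix p p ℂ} {z : ℂ}
    (hA : ∀ i k, AnalyticAt ℂ (fun ζ => A ζ i k) z) : AnalyticAt ℂ (fun ζ => (A ζ).det) z := by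
  simp only [Matrix.det_apply']
  exact Finset.analyticAt_fun_sum _ fun σ _ =>
    analyticAt_const.mul (Finset.analyticAt_fun_prod _ fun i _ => hA _ _)

theorem meromorphicAt_resolvent (A : Matrix (Fin n) (Fin n) ℂ) (z : ℂ) (i k : Fin n) :
    MeromorphicAt (fun ζ : ℂ => (ζ • 1 - A)⁻¹ i k) z := by
  have h : ∀ a b, AnalyticAt ℂ (fun ζ : ℂ => (ζ • (1 : Matrix (Fin n) (Fin n) ℂ) - A) a b) z :=
    fun a b => by
      simp only [Matrix.sub_apply, Matrix.smul_apply, smul_eq_mul]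
      exact (analyticAt_id.mul analyticAt_const).sub analyticAt_const
  simp only [Matrix.inv_def, Ring.inverse_eq_inv', Matrix.smul_apply, smul_eq_mul,
    Matrix.adjugate_apply]
  refine (analyticAt_det h).meromorphicAt.inv.mul (analyticAt_det fun a b => ?_).meromorphicAt
  by_cases hak : a = k
  · subst hak; simpa using analyticAt_const
  · simpa [Matrix.updateRow_ne hak] using h a b

theorem continuousAt_resolvent {A : Matrix (Fin n) (Fin n) ℂ} {z : ℂ} (hz : IsUnit (z • 1 - A)) :
    ContinuousAt (fun ζ : ℂ => (ζ • 1 - A)⁻¹) z := by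
  have h : Continuous fun ζ : ℂ => ζ • (1 : Matrix (Fin n) (Fin n) ℂ) - A := by fun_prop
  simp only [Matrix.inv_def, Ring.inverse_eq_inv']
  refine (h.matrix_det.continuousAt.inv₀ ?_).smul h.matrix_adjugate.continuousAt
  exact ((Matrix.isUnit_iff_isUnit_det _).1 hz).ne_zero

end Resolvent

/-! ### The explicit solution and the realization of the Weyl function. -/

section WeylFunction

variable {n m₁ m₂ : ℕ} (α S₀ : Matrix (Fin n) (Fin n) ℂ) (ϑ₁ : Matrix (Fin n) (Fin m₁) ℂ)
  (ϑ₂ : Matrix (Fin n) (Fin m₂) ℂ)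

/-- The function `-i ϑ₂* Σ₀⁻¹ (z - θ)⁻¹ ϑ₁`. -/
noncomputable def weylRealization (z : ℂ) : Matrix (Fin m₂) (Fin m₁) ℂ :=
  (-Complex.I) • (ϑ₂ᴴ * S₀⁻¹ * (z • (1 : Matrix (Fin n) (Fin n) ℂ) - theta α S₀ ϑ₁)⁻¹ * ϑ₁)

/-- The first block column of the transfer matrix function. -/
noncomputable def transferColumn (x : ℝ) (z : ℂ) : Matrix (Fin m₁ ⊕ Fin m₂) (Fin m₁) ℂ :=
  transfer α S₀ ϑ₁ ϑ₂ x z *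
    Matrix.fromRows (1 : Matrix (Fin m₁) (Fin m₁) ℂ) (0 : Matrix (Fin m₂) (Fin m₁) ℂ)

/-- The points at which the explicit fundamental solution may fail to be defined. -/
def exceptionalSet : Set ℂ := {z | ¬ IsUnit (z • 1 - α)} ∪ {z | ¬ IsUnit (z • 1 - αᴴ)}

/-- The explicit fundamental solution, valid off the exceptional set. -/
noncomputable def explicitSolution (x : ℝ) (z : ℂ) :
    Matrix (Fin m₁ ⊕ Fin m₂) (Fin m₁ ⊕ Fin m₂) ℂ :=
  transfer α S₀ ϑ₁ ϑ₂ x z * freeSolution m₁ m₂ x z * (transfer α S₀ ϑ₁ ϑ₂ 0 z)⁻¹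

theorem finite_exceptionalSet : (exceptionalSet α).Finite :=
  (finite_not_isUnit_sub α).union (finite_not_isUnit_sub αᴴ)

variable {α S₀ ϑ₁ ϑ₂}

theorem isUnit_of_notMem_exceptionalSet {z : ℂ} (hz : z ∉ exceptionalSet α) :
    IsUnit (z • 1 - α) ∧ IsUnit (z • 1 - αᴴ) := by
  simpa [exceptionalSet] using hz

theorem continuousAt_weylRealization (hS : S₀.PosDef)
    (hid : α * S₀ - S₀ * αᴴ = Complex.I • (ϑ₁ * ϑ₁ᴴ - ϑ₂ * ϑ₂ᴴ)) {z : ℂ} (hz : z ∈ upperHalf) :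
    ContinuousAt (weylRealization α S₀ ϑ₁ ϑ₂) z := by
  have h := continuousAt_resolvent (isUnit_sub_theta hS hid hz)
  have hl : Continuous fun R : Matrix (Fin n) (Fin n) ℂ =>
      (-Complex.I) • (ϑ₂ᴴ * S₀⁻¹ * R * ϑ₁) := by fun_prop
  exact hl.continuousAt.comp h

/-- Since `[I 0] j [I; 0] = I`, `j`-expansivity gives `P* j P ≥ I`. Nonsingularity follows from `P*P
= P* j P + P*(1 - j)P` with `1 - j = diag(0, 2) ≥ 0`. -/
theorem hasPropertyJ_transferColumn (hS : S₀.PosDef)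
    (hid : α * S₀ - S₀ * αᴴ = Complex.I • (ϑ₁ * ϑ₁ᴴ - ϑ₂ * ϑ₂ᴴ)) {x : ℝ} (hx : 0 ≤ x) :
    HasPropertyJ (transferColumn α S₀ ϑ₁ ϑ₂ x) := by
  have hJ : (Matrix.fromRows (1 : Matrix (Fin m₁) (Fin m₁) ℂ) (0 : Matrix (Fin m₂) (Fin m₁) ℂ))ᴴ *
      signature m₁ m₂ *
      Matrix.fromRows (1 : Matrix (Fin m₁) (Fin m₁) ℂ) (0 : Matrix (Fin m₂) (Fin m₁) ℂ) = 1 := by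
    rw [signature, Matrix.conjTranspose_fromRows_eq_fromCols_conjTranspose,
      Matrix.fromCols_mul_fromBlocks, Matrix.fromCols_mul_fromRows]
    simp
  have hform : ∀ z ∈ upperHalf, z ∉ exceptionalSet α →
      ((transferColumn α S₀ ϑ₁ ϑ₂ x z)ᴴ * signature m₁ m₂ *
        transferColumn α S₀ ϑ₁ ϑ₂ x z).PosDef := by
    intro z hz hze
    have hz : 0 < z.im := hz
    have e : (transferColumn α S₀ ϑ₁ ϑ₂ x z)ᴴ * signature m₁ m₂ *
        transferColumn α S₀ ϑ₁ ϑ₂ x z =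
        (Matrix.fromRows (1 : Matrix (Fin m₁) (Fin m₁) ℂ) (0 : Matrix (Fin m₂) (Fin m₁) ℂ))ᴴ *
          ((transfer α S₀ ϑ₁ ϑ₂ x z)ᴴ * signature m₁ m₂ * transfer α S₀ ϑ₁ ϑ₂ x z) *
        Matrix.fromRows (1 : Matrix (Fin m₁) (Fin m₁) ℂ) (0 : Matrix (Fin m₂) (Fin m₁) ℂ) := by
      simp only [transferColumn, Matrix.conjTranspose_mul, Matrix.mul_assoc]
    rw [e, conjTranspose_transfer_mul hS hid hx (isUnit_of_notMem_exceptionalSet hze).1,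
      Matrix.mul_add, Matrix.add_mul, hJ]
    refine Matrix.PosDef.one.add_posSemidef (Matrix.PosSemidef.conjTranspose_mul_mul_same ?_ _)
    exact Matrix.PosSemidef.smul
      ((posDef_bigSigma hS hx).inv.posSemidef.conjTranspose_mul_mul_same _)
      (by exact_mod_cast mul_nonneg zero_le_two hz.le)
  have hev : ∀ᶠ z in Filter.codiscreteWithin upperHalf,
      ((transferColumn α S₀ ϑ₁ ϑ₂ x z)ᴴ * signature m₁ m₂ *
        transferColumn α S₀ ϑ₁ ϑ₂ x z).PosDef := by
    filter_upwards [Filter.self_mem_codiscreteWithin upperHalf,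
      compl_finite_mem_codiscreteWithin (finite_exceptionalSet α)] with z h₁ h₂
    exact hform z h₁ h₂
  refine ⟨fun i k z _ => ?_, hev.mono fun z hz => ?_, hev.mono fun z hz => hz.posSemidef⟩
  · have h1 : ∀ a b, MeromorphicAt (fun ζ => transfer α S₀ ϑ₁ ϑ₂ x ζ a b) z := by
      intro a b
      simp only [transfer, Matrix.add_apply, Matrix.smul_apply, smul_eq_mul]
      refine (MeromorphicAt.const _ _).add ((MeromorphicAt.const _ _).mul
        (MeromorphicAt.fun_sum fun c _ => (MeromorphicAt.const _ _).mul
          (MeromorphicAt.fun_sum fun d _ =>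
            (meromorphicAt_resolvent α z _ _).mul (MeromorphicAt.const _ _))))
    simp only [transferColumn, Matrix.mul_apply]
    exact MeromorphicAt.fun_sum fun c _ => (h1 _ _).mul (MeromorphicAt.const _ _)
  · have e : (transferColumn α S₀ ϑ₁ ϑ₂ x z)ᴴ * transferColumn α S₀ ϑ₁ ϑ₂ x z =
        (transferColumn α S₀ ϑ₁ ϑ₂ x z)ᴴ * signature m₁ m₂ * transferColumn α S₀ ϑ₁ ϑ₂ x z +
        (transferColumn α S₀ ϑ₁ ϑ₂ x z)ᴴ * (1 - signature m₁ m₂) *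
          transferColumn α S₀ ϑ₁ ϑ₂ x z := by
      simp only [Matrix.mul_sub, Matrix.sub_mul, Matrix.mul_one]; abel
    rw [e]
    refine hz.add_posSemidef (Matrix.PosSemidef.conjTranspose_mul_mul_same ?_ _)
    have : (1 : Matrix (Fin m₁ ⊕ Fin m₂) (Fin m₁ ⊕ Fin m₂) ℂ) - signature m₁ m₂ =
        Matrix.diagonal (Sum.elim (fun _ => 0) fun _ => 2) := by
      ext (i | i) (k | k) <;>
        simp [signature, Matrix.one_apply, Matrix.diagonal_apply]
      split_ifs <;> norm_num
    rw [this]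
    refine Matrix.PosSemidef.diagonal ?_
    rintro (i | i) <;> simp

theorem hasEntryDeriv_explicitSolution (hS : S₀.PosDef)
    (hid : α * S₀ - S₀ * αᴴ = Complex.I • (ϑ₁ * ϑ₁ᴴ - ϑ₂ * ϑ₂ᴴ)) {z : ℂ}
    (hz : z ∉ exceptionalSet α) {x : ℝ} (hx : 0 ≤ x) :
    HasEntryDeriv (fun x => explicitSolution α S₀ ϑ₁ ϑ₂ x z)
      (coefficient (pseudoExpPotential α S₀ ϑ₁ ϑ₂) x z * explicitSolution α S₀ ϑ₁ ϑ₂ x z) x := by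
  refine (((hasEntryDeriv_transfer hS hid hx (isUnit_of_notMem_exceptionalSet hz).1).mul
    (hasEntryDeriv_freeSolution x z)).mul_const _).congr_deriv ?_
  simp only [explicitSolution, Matrix.sub_mul, Matrix.add_mul, Matrix.smul_mul, Matrix.mul_smul,
    Matrix.mul_assoc]
  abel

theorem explicitSolution_zero (hS : S₀.PosDef)
    (hid : α * S₀ - S₀ * αᴴ = Complex.I • (ϑ₁ * ϑ₁ᴴ - ϑ₂ * ϑ₂ᴴ)) {z : ℂ}
    (hz : z ∉ exceptionalSet α) : explicitSolution α S₀ ϑ₁ ϑ₂ 0 z = 1 := by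
  obtain ⟨h₁, h₂⟩ := isUnit_of_notMem_exceptionalSet hz
  rw [explicitSolution, freeSolution_zero, Matrix.mul_one, Matrix.mul_nonsing_inv _
    ((Matrix.isUnit_iff_isUnit_det _).1 (isUnit_transfer hS hid le_rfl h₁ h₂))]

theorem isUnit_explicitSolution (hS : S₀.PosDef)
    (hid : α * S₀ - S₀ * αᴴ = Complex.I • (ϑ₁ * ϑ₁ᴴ - ϑ₂ * ϑ₂ᴴ)) {z : ℂ}
    (hz : z ∉ exceptionalSet α) {x : ℝ} (hx : 0 ≤ x) :
    IsUnit (explicitSolution α S₀ ϑ₁ ϑ₂ x z) := by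
  obtain ⟨h₁, h₂⟩ := isUnit_of_notMem_exceptionalSet hz
  exact ((isUnit_transfer hS hid hx h₁ h₂).mul
    (IsUnit.of_mul_eq_one _ (freeSolution_mul_neg x z))).mul
    (Matrix.isUnit_nonsing_inv_iff.2 (isUnit_transfer hS hid le_rfl h₁ h₂))

/-- The factor `W(x,z)` cancels and `e^{-ixzj}` acts on `[I; 0]` as a scalar, so `x` survives only
in that scalar. -/
theorem inv_explicitSolution_mul_transferColumn (hS : S₀.PosDef)
    (hid : α * S₀ - S₀ * αᴴ = Complex.I • (ϑ₁ * ϑ₁ᴴ - ϑ₂ * ϑ₂ᴴ)) {z : ℂ}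
    (hz : z ∉ exceptionalSet α) {x : ℝ} (hx : 0 ≤ x) :
    (explicitSolution α S₀ ϑ₁ ϑ₂ x z)⁻¹ * transferColumn α S₀ ϑ₁ ϑ₂ x z =
      Complex.exp (-(Complex.I * z * x)) • Matrix.fromRows
        (1 + Complex.I • (ϑ₁ᴴ * S₀⁻¹ * ((z • 1 - α)⁻¹ * ϑ₁)))
        ((-Complex.I) • (ϑ₂ᴴ * S₀⁻¹ * ((z • 1 - α)⁻¹ * ϑ₁))) := by
  obtain ⟨h₁, h₂⟩ := isUnit_of_notMem_exceptionalSet hz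
  have hW := (Matrix.isUnit_iff_isUnit_det _).1 (isUnit_transfer hS hid hx h₁ h₂)
  have hW0 := (Matrix.isUnit_iff_isUnit_det _).1 (isUnit_transfer hS hid le_rfl h₁ h₂)
  have hE : (freeSolution m₁ m₂ x z)⁻¹ = freeSolution m₁ m₂ (-x) z :=
    Matrix.inv_eq_right_inv (freeSolution_mul_neg x z)
  rw [explicitSolution, transferColumn, Matrix.mul_inv_rev, Matrix.mul_inv_rev, hE,
    Matrix.nonsing_inv_nonsing_inv _ hW0]
  rw [Matrix.mul_assoc, Matrix.mul_assoc, Matrix.nonsing_inv_mul_cancel_left _ _ hW]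
  have hEc : freeSolution m₁ m₂ (-x) z *
      Matrix.fromRows (1 : Matrix (Fin m₁) (Fin m₁) ℂ) (0 : Matrix (Fin m₂) (Fin m₁) ℂ) =
      Complex.exp (-(Complex.I * z * x)) • Matrix.fromRows 1 0 := by
    rw [freeSolution, Matrix.fromBlocks_mul_fromRows]
    ext (i | i) k <;> simp
  rw [hEc, Matrix.mul_smul]
  congr 1
  rw [transfer, bigSigma_zero, bigLambda_zero, signature,
    Matrix.conjTranspose_fromCols_eq_fromRows_conjTranspose, Matrix.fromRows_mul,
    Matrix.fromBlocks_mul_fromRows, Matrix.mul_fromCols, Matrix.fromRows_mul_fromCols,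
    ← Matrix.fromBlocks_one, Matrix.fromBlocks_smul, Matrix.fromBlocks_add,
    Matrix.fromBlocks_mul_fromRows]
  simp

theorem moebius_explicitSolution (hS : S₀.PosDef)
    (hid : α * S₀ - S₀ * αᴴ = Complex.I • (ϑ₁ * ϑ₁ᴴ - ϑ₂ * ϑ₂ᴴ)) {z : ℂ} (hzu : z ∈ upperHalf)
    (hz : z ∉ exceptionalSet α) {x : ℝ} (hx : 0 ≤ x) :
    moebius (explicitSolution α S₀ ϑ₁ ϑ₂ x z) (transferColumn α S₀ ϑ₁ ϑ₂ x z) =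
      weylRealization α S₀ ϑ₁ ϑ₂ z := by
  obtain ⟨h₁, h₂⟩ := isUnit_of_notMem_exceptionalSet hz
  have hR : (z • 1 - α)⁻¹ * (z • 1 - α) = 1 :=
    Matrix.nonsing_inv_mul _ ((Matrix.isUnit_iff_isUnit_det _).1 h₁)
  have hT : (z • 1 - theta α S₀ ϑ₁) * (z • 1 - theta α S₀ ϑ₁)⁻¹ = 1 :=
    Matrix.mul_nonsing_inv _ ((Matrix.isUnit_iff_isUnit_det _).1 (isUnit_sub_theta hS hid hzu))
  rw [moebius, Matrix.mul_assoc _ (_⁻¹), Matrix.mul_assoc _ (_⁻¹),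
    inv_explicitSolution_mul_transferColumn hS hid hz hx, weylRealization]
  set R := (z • 1 - α)⁻¹
  set T := (z • 1 - theta α S₀ ϑ₁)⁻¹
  have hc := Complex.exp_ne_zero (-(Complex.I * z * x))
  set c := Complex.exp (-(Complex.I * z * x))
  -- A resolvent identity for `z - α = (z - θ) - iϑ₁ϑ₁*Σ₀⁻¹`. It supplies both the inverse of the
  -- upper block and the simplified product with the lower one.
  have hRT : R * ϑ₁ * (1 - Complex.I • (ϑ₁ᴴ * S₀⁻¹ * (T * ϑ₁))) = T * ϑ₁ := by
    calc R * ϑ₁ * (1 - Complex.I • (ϑ₁ᴴ * S₀⁻¹ * (T * ϑ₁)))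
        = R * (1 - Complex.I • (ϑ₁ * ϑ₁ᴴ * S₀⁻¹) * T) * ϑ₁ := by
          simp only [Matrix.mul_sub, Matrix.sub_mul, Matrix.mul_one, Matrix.mul_smul,
            Matrix.smul_mul, Matrix.mul_assoc]
      _ = R * ((z • 1 - theta α S₀ ϑ₁ - Complex.I • (ϑ₁ * ϑ₁ᴴ * S₀⁻¹)) * T) * ϑ₁ := by
          rw [Matrix.sub_mul _ _ T, hT]
      _ = R * ((z • 1 - α) * T) * ϑ₁ := by rw [theta]; congr 3; abel
      _ = T * ϑ₁ := by rw [← Matrix.mul_assoc R, hR, Matrix.one_mul]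
  have hinv : (1 + Complex.I • (ϑ₁ᴴ * S₀⁻¹ * (R * ϑ₁))) *
      (1 - Complex.I • (ϑ₁ᴴ * S₀⁻¹ * (T * ϑ₁))) = 1 := by
    rw [Matrix.add_mul, Matrix.smul_mul, Matrix.mul_assoc _ (R * ϑ₁), hRT, Matrix.one_mul,
      sub_add_cancel]
  have hinv' : (c • (1 + Complex.I • (ϑ₁ᴴ * S₀⁻¹ * (R * ϑ₁))))⁻¹ =
      c⁻¹ • (1 - Complex.I • (ϑ₁ᴴ * S₀⁻¹ * (T * ϑ₁))) := by
    refine Matrix.inv_eq_right_inv ?_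
    rw [Matrix.smul_mul, Matrix.mul_smul, hinv, smul_smul, mul_inv_cancel₀ hc, one_smul]
  rw [Matrix.mul_smul, Matrix.mul_smul, Matrix.fromCols_mul_fromRows, Matrix.fromCols_mul_fromRows]
  simp only [Matrix.zero_mul, Matrix.one_mul, zero_add, add_zero]
  rw [hinv', Matrix.smul_mul, Matrix.mul_smul, smul_smul, mul_inv_cancel₀ hc, one_smul,
    Matrix.smul_mul, Matrix.mul_assoc (ϑ₂ᴴ * S₀⁻¹), hRT]
  simp only [Matrix.mul_assoc]

theorem continuousOn_pseudoExpPotential (hS : S₀.PosDef) (i : Fin m₁) (k : Fin m₂) :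
    ContinuousOn (fun x => pseudoExpPotential α S₀ ϑ₁ ϑ₂ x i k) (Set.Ici 0) := by
  intro x hx
  have h := ((((((hasEntryDeriv_exp Complex.I αᴴ x).const_mul ϑ₁ᴴ).mul
    ((hasEntryDeriv_bigSigma α S₀ ϑ₁ ϑ₂ x).inv (posDef_bigSigma hS hx).isUnit)).mul
    (hasEntryDeriv_exp Complex.I α x)).mul_const ϑ₂).const_smul (-2 * Complex.I)) i k
  exact h.continuousAt.continuousWithinAt

end WeylFunction

end DiracSystem

/-! ### Assembly of the theorem. -/

open DiracSystem in
theorem mainTheorem2 {n m₁ m₂ : ℕ} (v : ℝ → Matrix (Fin m₁) (Fin m₂) ℂ)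
    (α S₀ : Matrix (Fin n) (Fin n) ℂ) (ϑ₁ : Matrix (Fin n) (Fin m₁) ℂ)
    (ϑ₂ : Matrix (Fin n) (Fin m₂) ℂ)
    (hv : DiracSystem.IsGeneralizedPseudoExponential v α S₀ ϑ₁ ϑ₂) :
    (∀ z ∈ DiracSystem.upperHalf,
      IsUnit (z • (1 : Matrix (Fin n) (Fin n) ℂ) - DiracSystem.theta α S₀ ϑ₁)) ∧
    DiracSystem.IsWeylFunction v (fun z =>
      (-Complex.I) • (ϑ₂ᴴ * S₀⁻¹ *
        (z • (1 : Matrix (Fin n) (Fin n) ℂ) - DiracSystem.theta α S₀ ϑ₁)⁻¹ * ϑ₁)) := by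
  obtain ⟨hS, hid, hpot⟩ := hv
  refine ⟨fun z hz => isUnit_sub_theta hS hid hz, ?_⟩
  have hveq : ∀ x, 0 ≤ x → v x = pseudoExpPotential α S₀ ϑ₁ ϑ₂ x := hpot
  have hcont : ∀ i k, ContinuousOn (fun x => v x i k) (Set.Ici 0) := fun i k =>
    (continuousOn_pseudoExpPotential hS i k).congr fun x hx => by rw [hveq x hx]
  have hderiv : ∀ z ∉ exceptionalSet α, ∀ x, 0 ≤ x →
      HasEntryDeriv (fun x => explicitSolution α S₀ ϑ₁ ϑ₂ x z)
        (coefficient v x z * explicitSolution α S₀ ϑ₁ ϑ₂ x z) x := by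
    intro z hz x hx
    rw [show coefficient v x z = coefficient (pseudoExpPotential α S₀ ϑ₁ ϑ₂) x z by
      rw [coefficient, coefficient, hveq x hx]]
    exact hasEntryDeriv_explicitSolution hS hid hz hx
  refine ⟨fun i k => (hcont i k).locallyIntegrableOn measurableSet_Ici, ?_⟩
  obtain ⟨u, hu, hue⟩ := exists_isFundamentalSolution hcont (exceptionalSet α)
    (explicitSolution α S₀ ϑ₁ ϑ₂) (fun z hz => explicitSolution_zero hS hid hz) hderiv
  refine ⟨u, hu, fun z hz => ?_⟩
  change _ = {weylRealization α S₀ ϑ₁ ϑ₂ z}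
  have hopen : IsOpen upperHalf := isOpen_lt continuous_const Complex.continuous_im
  have hupper : ∀ᶠ ζ in 𝓝[≠] z, ζ ∈ upperHalf :=
    eventually_nhdsWithin_of_eventually_nhds (hopen.mem_nhds hz)
  -- The half-plane is open, so a property holding off a discrete set holds on a punctured
  -- neighbourhood of `z`, where the limits defining the values at `z` are taken.
  have hcodisc : ∀ {p : ℂ → Prop}, (∀ᶠ ζ in Filter.codiscreteWithin upperHalf, p ζ) →
      ∀ᶠ ζ in 𝓝[≠] z, p ζ := by
    intro p hp
    filter_upwards [mem_codiscreteWithin_iff_forall_mem_nhdsNE.1 hp z hz, hupper] with ζ h₁ h₂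
    exact h₁.resolve_right (not_not.2 h₂)
  have hnear : ∀ᶠ ζ in 𝓝[≠] z, ζ ∈ upperHalf ∧ ζ ∉ exceptionalSet α :=
    hupper.and (hcodisc (compl_finite_mem_codiscreteWithin (finite_exceptionalSet α)))
  have hdisc : ∀ x, 0 ≤ x → ∀ P, HasPropertyJ P → ∀ ξ, ∀ᶠ ζ in 𝓝[≠] z,
      0 ≤ signatureForm (explicitSolution α S₀ ϑ₁ ϑ₂ x ζ *ᵥ
        Sum.elim ξ (moebius (explicitSolution α S₀ ϑ₁ ϑ₂ x ζ) (P ζ) *ᵥ ξ)) := by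
    intro x hx P hP ξ
    filter_upwards [hcodisc hP.nonsingular, hcodisc hP.nonneg, hnear] with ζ h₁ h₂ h₃
    refine signatureForm_moebius_nonneg (isUnit_explicitSolution hS hid h₃.2 hx) (fun y => ?_)
      h₁ h₂ ξ
    have h := antitoneOn_signatureForm (hderiv ζ h₃.2) (le_of_lt h₃.1) y Set.self_mem_Ici hx hx
    simpa [explicitSolution_zero hS hid h₃.2] using h
  refine Set.eq_singleton_iff_unique_mem.2 ⟨?_, fun ψ hψ => ?_⟩
  · refine Set.mem_iInter₂.2 fun x hx => ⟨transferColumn α S₀ ϑ₁ ϑ₂ x,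
      hasPropertyJ_transferColumn hS hid hx, ?_⟩
    refine ((continuousAt_weylRealization hS hid hz).tendsto.mono_left
      nhdsWithin_le_nhds).congr' ?_
    filter_upwards [hnear] with ζ hζ
    rw [hue ζ hζ.2, moebius_explicitSolution hS hid hζ.1 hζ.2 hx]
  · have hbound : ∀ ξ, ∀ x, 0 ≤ x → x * z.im *
        sqNorm (ψ *ᵥ ξ - weylRealization α S₀ ϑ₁ ϑ₂ z *ᵥ ξ) ≤ 2 * sqNorm ξ := by
      intro ξ x hx
      obtain ⟨P, hP, hlim⟩ := Set.mem_iInter₂.1 hψ x hx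
      have hmv : Continuous fun A : Matrix (Fin m₂) (Fin m₁) ℂ => A *ᵥ ξ := by fun_prop
      have h₁ := (hmv.tendsto _).comp hlim
      have h₂ := (hmv.tendsto _).comp ((continuousAt_weylRealization hS hid hz).tendsto.mono_left
        (nhdsWithin_le_nhds (s := {z}ᶜ)))
      have him : Filter.Tendsto (fun ζ : ℂ => x * ζ.im) (𝓝[≠] z) (𝓝 (x * z.im)) :=
        ((continuous_const.mul Complex.continuous_im).tendsto z).mono_left nhdsWithin_le_nhds
      -- The disc estimate is proved at nearby non-exceptional `ζ` and passes to the limit, so `z`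
      -- itself may be exceptional.
      refine le_of_tendsto (him.mul ((continuous_sqNorm.tendsto _).comp (h₁.sub h₂))) ?_
      filter_upwards [hnear, hdisc x hx P hP ξ,
        hdisc x hx _ (hasPropertyJ_transferColumn hS hid hx) ξ] with ζ hζ h₃ h₄
      rw [moebius_explicitSolution hS hid hζ.1 hζ.2 hx] at h₄
      simp only [Function.comp_apply, hue ζ hζ.2]
      exact mul_sqNorm_sub_le (hderiv ζ hζ.2) (explicitSolution_zero hS hid hζ.2)
        (le_of_lt hζ.1) hx h₃ h₄
    have hzero : ∀ ξ, ψ *ᵥ ξ = weylRealization α S₀ ϑ₁ ϑ₂ z *ᵥ ξ := by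
      intro ξ
      have hz : 0 < z.im := hz
      refine sub_eq_zero.1 (sqNorm_eq_zero.1 (le_antisymm ?_ (sqNorm_nonneg _)))
      by_contra! hpos
      -- This `x` makes the left side of the bound equal to `2|ξ|² + 1`.
      have h := hbound ξ ((2 * sqNorm ξ + 1) /
        (z.im * sqNorm (ψ *ᵥ ξ - weylRealization α S₀ ϑ₁ ϑ₂ z *ᵥ ξ)))
        (div_nonneg (by linarith [sqNorm_nonneg ξ]) (by positivity))
      rw [mul_assoc, div_mul_cancel₀ _ (by positivity)] at h
      linarith
    exact Matrix.ext_of_mulVec_single fun i => hzero _
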